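/- **Setting.** Let $\Sigma$ be a finite alphabet. An *unordered word* is a multiset of symbols of $\Sigma$; $\uplus$ is multiset union and $\varepsilon$ the empty word. For a language $L$ of unordered words, $n\in\mathbb N_0$ and $m\in\mathbb N_0\cup\{\infty\}$, let $L^{[n,m]}=\{w_1\uplus\dots\uplus w_i\mid w_1,\dots,w_i\in L,\ n\le i\le m\}$ and $L^{[n,m]^?}=L^{[n,m]}\cup\{\varepsilon\}$; write $1=[1,1]$ and $?=[0,1]$. An *atom* is an expression $(a_1^{I_1}\,\|\,\dots\,\|\,a_k^{I_k})$ with $k\ge 1$, $a_i\in\Sigma$ and $I_i\in\{1,?\}$. A *disjunction-free interval multiplicity expression* (IME) is an expression $A_1^{I_1}\,\|\,\dots\,\|\,A_k^{I_k}$ ($k\ge 0$; for $k=0$ it is $\epsilon$, which defines $\{\varepsilon\}$) where the $A_i$ are atoms, the $I_i$ are intervals $[n,m]$ or $[n,m]^?$, and no symbol occurs twice; $\|$ denotes unordered concatenation, $L(E_1\,\|\,E_2)=\{w_1\uplus w_2\mid w_i\in L(E_i)\}$. An *IMS* $S=(\mathrm{root}_S,R_S)$ consists of a root label $\mathrm{root}_S\in\Sigma$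 and a map $R_S$ from $\Sigma$ to IMEs. A finite unordered $\Sigma$-labeled tree $t$ *satisfies* $S$ if its root is labeled $\mathrm{root}_S$ and, for every node $n$, the multiset of the labels of the children of $n$ belongs to $L(R_S(\mathrm{lab}_t(n)))$. A *twig query* $q$ is a finite rooted tree whose nodes are labeled by elements of $\Sigma\cup\{\star\}$ and each of whose edges is either a child edge or a descendant edge. A tree $t$ *satisfies* $q$ if there is a (not necessarily injective) map from the nodes of $q$ to the nodes of $t$ that sends root to root, child edges to parent-child pairs, descendant edges to pairs in the transitive closure of the parent-child relation, and every node with a label other than $\star$ to a node with the same label. The query $q$ is *satisfiable by* $S$ if some tree satisfies both $S$ and $q$, and *implied by* $S$ if every tree satisfying $S$ satisfies $q$. The *existential* (resp. *universal*) *dependency graph* $G_S^\exists$ (resp. $G_S^\forall$) has node set $\Sigma$, root $\mathrm{root}_S$, and an edge $(a,b)$ iff $b$ occurs in some word (resp. in every word) of $L(R_S(a))$. An *embedding* of $q$ in such a graph is a map from the nodes of $q$ to $\Sigma$ that sends root to root, child edges to edges, descendant edges to pairs in the transitive closure of the edge relation, and every node with a label $a\neq\star$ to $a$. $S$ is *satisfiable*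 if some tree satisfies it. It is *trimmed* if every symbol $a$ with $L(R_S(a))\ne\{\varepsilon\}$ labels a node of some tree satisfying $S$ (a symbol $a$ with $L(R_S(a))=\{\varepsilon\}$ counts as having no rule). **Theorem.** The following two problems are decidable in polynomial time (by deterministic Turing machines). The input is an IMS $S$ and a twig query $q$ over an alphabet that is part of the input, with symbols and interval bounds written in binary; neither satisfiability nor trimmedness of $S$ is assumed. 1. $\mathrm{SAT}_{\mathit{IMS},\mathit{Twig}}$: is $q$ satisfiable by $S$? 2. $\mathrm{IMPL}_{\mathit{IMS},\mathit{Twig}}$: is $q$ implied by $S$? Moreover, for every satisfiable and trimmed IMS $S$ and every twig query $q$: $q$ is satisfiable by $S$ iff $q$ embeds in $G_S^\exists$, and $q$ is implied by $S$ iff $q$ embeds in $G_S^\forall$. -/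

import Mathlib

namespace Unordered

/-! ### Unordered words and interval multiplicities -/

/-- An unordered word over `A` is a multiset of symbols; a language is a set of such words. -/
abbrev Lang (A : Type) : Type := Set (Multiset A)

/-- The interval multiplicity `[lo, hi]` (if `orEmpty = false`) or `[lo, hi]^?`
(if `orEmpty = true`), with `hi` possibly `∞`. -/
structure Interval where
  lo : ℕ
  hi : ℕ∞
  orEmpty : Bool

/-- The multiplicity `1 = [1,1]`. -/
def Interval.one : Interval := ⟨1, 1, false⟩

/-- The multiplicity `? = [0,1]`. -/
def Interval.optional : Interval := ⟨0, 1, false⟩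

/-- `L^I`: all `w₁ ⊎ ... ⊎ wᵢ` with every `wⱼ ∈ L` and `lo ≤ i ≤ hi`,
together with the empty word if `I = [lo, hi]^?`. -/
def Lang.iterate {A : Type} (L : Lang A) (I : Interval) : Lang A :=
  {w | (∃ ws : List (Multiset A), (∀ u ∈ ws, u ∈ L) ∧ I.lo ≤ ws.length ∧
          (ws.length : ℕ∞) ≤ I.hi ∧ w = ws.sum) ∨
        (I.orEmpty = true ∧ w = 0)}

/-- Unordered concatenation of a finite list of languages. -/
def Lang.concat {A : Type} : List (Lang A) → Lang A
  | [] => {0}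
  | L :: Ls => {w | ∃ u ∈ L, ∃ v ∈ Lang.concat Ls, w = u + v}

/-! ### Disjunction-free interval multiplicity expressions -/

/-- An atom `(a₁^{I₁} || ... || a_k^{I_k})`, every `Iᵢ` being `1` (flag `false`) or `?`
(flag `true`). -/
abbrev Atom (A : Type) : Type := List (A × Bool)

/-- The language of an atom. -/
def Atom.lang {A : Type} (B : Atom A) : Lang A :=
  Lang.concat (B.map fun p =>
    Lang.iterate {({p.1} : Multiset A)} (if p.2 then Interval.optional else Interval.one))

/-- A disjunction-free interval multiplicity expression `A₁^{I₁} || ... || A_k^{I_k}`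
(the empty list is `ε`), in which no symbol occurs twice. -/
structure IME (A : Type) where
  factors : List (Atom A × Interval)
  atom_ne_nil : ∀ f ∈ factors, f.1 ≠ []
  nodup : (factors.flatMap fun f => f.1.map Prod.fst).Nodup

/-- The language of an IME. -/
def IME.lang {A : Type} (E : IME A) : Lang A :=
  Lang.concat (E.factors.map fun f => Lang.iterate (Atom.lang f.1) f.2)

/-- The symbols present in all words of `L(E)`. -/
def IME.symbolsForall {A : Type} (E : IME A) : Set A := {a | ∀ w ∈ E.lang, a ∈ w}

/-- The symbols present in at least one word of `L(E)`. -/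
def IME.symbolsExists {A : Type} (E : IME A) : Set A := {a | ∃ w ∈ E.lang, a ∈ w}

/-- A disjunction-free interval multiplicity schema over the alphabet `A`. -/
structure IMS (A : Type) where
  root : A
  rule : A → IME A

/-! ### Trees and twig queries -/

/-- Finite unordered trees with nodes labeled by symbols of `A`. -/
structure LabTree (A : Type) where
  Node : Type
  [fintypeNode : Fintype Node]
  root : Node
  lab : Node → A
  child : Node → Node → Prop
  acyclic : ∀ n, ¬ Relation.TransGen child n n
  existsUnique_parent : ∀ n, n ≠ root → ∃! m, child m n

/-- The unordered word formed by the labels of the children of a node. -/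
noncomputable def LabTree.childWord {A : Type} (t : LabTree A) (n : t.Node) : Multiset A :=
  letI := t.fintypeNode
  letI := Classical.decPred (t.child n)
  (Finset.univ.filter (t.child n)).val.map t.lab

/-- `t ⊨ S`. -/
def LabTree.Satisfies {A : Type} (t : LabTree A) (S : IMS A) : Prop :=
  t.lab t.root = S.root ∧ ∀ n, t.childWord n ∈ (S.rule (t.lab n)).lang

/-- Twig queries over `A`. The finite node set is `{0, ..., size - 1}`, and the label `none`
is the wildcard `⋆`. -/
structure Twig (A : Type) where
  size : ℕ
  root : Fin size
  lab : Fin size → Option A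
  child : Finset (Fin size × Fin size)
  desc : Finset (Fin size × Fin size)
  disjoint : Disjoint child desc
  acyclic : ∀ n, ¬ Relation.TransGen (fun m m' => (m, m') ∈ child ∪ desc) n n
  existsUnique_parent : ∀ n, n ≠ root → ∃! m, (m, n) ∈ child ∪ desc

/-- `t ⊨ q`: there is a (not necessarily injective) embedding of `q` in the tree `t`. -/
def LabTree.Models {A : Type} (t : LabTree A) (q : Twig A) : Prop :=
  ∃ f : Fin q.size → t.Node,
    f q.root = t.root ∧
    (∀ n n', (n, n') ∈ q.child → t.child (f n) (f n')) ∧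
    (∀ n n', (n, n') ∈ q.desc → Relation.TransGen t.child (f n) (f n')) ∧
    (∀ n, q.lab n = none ∨ q.lab n = some (t.lab (f n)))

/-- The query `q` is satisfiable by the schema `S`. -/
def IMS.Sat {A : Type} (S : IMS A) (q : Twig A) : Prop :=
  ∃ t : LabTree A, t.Satisfies S ∧ t.Models q

/-- The query `q` is implied by the schema `S`. -/
def IMS.Implies {A : Type} (S : IMS A) (q : Twig A) : Prop :=
  ∀ t : LabTree A, t.Satisfies S → t.Models q

/-! ### Dependency graphs -/

/-- The schema `S` is satisfiable. -/
def IMS.Satisfiable {A : Type} (S : IMS A) : Prop := ∃ t : LabTree A, t.Satisfies S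

/-- The symbol `a` is reachable in `S`: it labels a node of some tree satisfying `S`. -/
def IMS.Reachable {A : Type} (S : IMS A) (a : A) : Prop :=
  ∃ t : LabTree A, t.Satisfies S ∧ ∃ n, t.lab n = a

/-- `S` has rules only for reachable symbols, where a symbol whose content model defines
just the empty word counts as having no rule. -/
def IMS.Trimmed {A : Type} (S : IMS A) : Prop :=
  ∀ a, (S.rule a).lang ≠ {0} → S.Reachable a

/-- Rooted directed graphs with node set `A`. -/
structure DepGraph (A : Type) where
  root : A
  edge : A → A → Prop

/-- The existential dependency graph of `S`. -/
def IMS.existsGraph {A : Type} (S : IMS A) : DepGraph A :=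
  ⟨S.root, fun a b => b ∈ (S.rule a).symbolsExists⟩

/-- The universal dependency graph of `S`. -/
def IMS.forallGraph {A : Type} (S : IMS A) : DepGraph A :=
  ⟨S.root, fun a b => b ∈ (S.rule a).symbolsForall⟩

/-- There is an embedding of the query `q` in the graph `G`. -/
def DepGraph.Embeds {A : Type} (G : DepGraph A) (q : Twig A) : Prop :=
  ∃ f : Fin q.size → A,
    f q.root = G.root ∧
    (∀ n n', (n, n') ∈ q.child → G.edge (f n) (f n')) ∧
    (∀ n n', (n, n') ∈ q.desc → Relation.TransGen G.edge (f n) (f n')) ∧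
    (∀ n, q.lab n = none ∨ q.lab n = some (f n))

/-! ### The decision problems -/

/-- An instance: a schema and a query over an alphabet `{0, ..., alphabetSize - 1}`,
which is itself part of the input. -/
structure Instance where
  alphabetSize : ℕ
  schema : IMS (Fin alphabetSize)
  query : Twig (Fin alphabetSize)

/-- Query satisfiability by a schema, for disjunction-free interval multiplicity schemas and
twig queries. -/
def satProblem : Set Instance := {x | x.schema.Sat x.query}

/-- Query implication by a schema, for disjunction-free interval multiplicity schemas and
twig queries. -/
def implProblem : Set Instance := {x | x.schema.Implies x.query}

/-- The (finite) alphabet in which instances are written down: binary digits and keywords. -/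
inductive Letter where
  | bit (b : Bool)
  | schemaRoot | rule | atom | required | optional
  | lower | upper | infinity | orEmpty
  | queryRoot | node | label | wildcard
  | child | desc | target

/-- A natural number in binary. -/
def digits (n : ℕ) : List Letter := (Computability.encodeNat n).map Letter.bit

/-- The upper end of an interval. -/
def encodeUpper : ℕ∞ → List Letter
  | none => [Letter.infinity]
  | some m => digits m

def encodeInterval (I : Interval) : List Letter :=
  Letter.lower :: digits I.lo ++ Letter.upper :: encodeUpper I.hi ++
    if I.orEmpty then [Letter.orEmpty] else []

def encodeAtom {k : ℕ} (B : Atom (Fin k)) : List Letter :=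
  Letter.atom :: B.flatMap fun p =>
    (if p.2 then Letter.optional else Letter.required) :: digits p.1

def encodeIME {k : ℕ} (E : IME (Fin k)) : List Letter :=
  E.factors.flatMap fun f => encodeAtom f.1 ++ encodeInterval f.2

/-- The root label followed by the list of all rules `a → R(a)`. -/
def encodeIMS {k : ℕ} (S : IMS (Fin k)) : List Letter :=
  Letter.schemaRoot :: digits S.root ++
    (List.finRange k).flatMap fun a : Fin k => Letter.rule :: digits a ++ encodeIME (S.rule a)

def encodeLabel {k : ℕ} : Option (Fin k) → List Letter
  | none => [Letter.wildcard]
  | some a => Letter.label :: digits a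

/-- The list of the edges in `E`, each one preceded by the keyword `l`. -/
def encodeEdges {n : ℕ} (l : Letter) (E : Finset (Fin n × Fin n)) : List Letter :=
  ((List.finRange n ×ˢ List.finRange n).filter (· ∈ E)).flatMap fun e =>
    l :: digits e.1 ++ Letter.target :: digits e.2

/-- The root node, the list of all nodes with their labels, and the two lists of edges. -/
def encodeTwig {k : ℕ} (q : Twig (Fin k)) : List Letter :=
  Letter.queryRoot :: digits q.root ++
    ((List.finRange q.size).flatMap fun v : Fin q.size =>
      Letter.node :: digits v ++ encodeLabel (q.lab v)) ++
    encodeEdges Letter.child q.child ++ encodeEdges Letter.desc q.desc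

/-- The word that represents an instance. -/
def Instance.encode (x : Instance) : List Letter :=
  encodeIMS x.schema ++ encodeTwig x.query

/-- The decision problem `P`, whose instances `x` are given as words `enc x`, is in PTIME: a
Turing machine outputs the correct yes/no answer on every instance, within a number of steps
that is polynomial in the length of the word. -/
def InPTIME {α Γ : Type} (enc : α → List Γ) (P : Set α) : Prop :=
  ∃ f : α → Bool, (∀ x, f x = true ↔ x ∈ P) ∧
    Nonempty (Turing.TM2ComputableInPolyTime enc Computability.encodeBool f)

end Unordered

/-! ### Structured programs over stacks and their compilation to `TM2` machines -/

/-! Semantics. Without disjunction, the factors of an expression contribute to a word independently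
of each other. Two extremal words result. Among the words with all symbols in a given set, if there
are any, one contains every symbol that occurs in any of them (`IME.hasMax_lang`). Every nonempty
language has a word made only of symbols that are present in all words (`IME.exists_min`).

Call a symbol productive if it labels the root of a finite tree obeying the rules. Expanding nodes
by maximal words over productive symbols gives, for each depth, one tree that contains all label
paths of that length of the dependency graph restricted to productive symbols. Query homomorphisms
need not be injective, so one occurrence of each path suffices, and embedding into this pruned graph
is the same as satisfiability when the root is productive (`IMS.sat_iff`). Expanding nodes by
minimal words gives a tree all of whose edges lie in the universal graph, while every universal edge
is present in every tree of the schema; this settles implication (`IMS.implies_iff`). In a trimmed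
schema all symbols are productive, so pruning changes nothing (`IMS.Trimmed.prunedGraph_eq`).

Algorithm. The unproductive symbols, the symbols unreachable from a given one, and the pairs (query
node, symbol) at which the subquery embeds are greatest fixed points over polynomially many
candidates. Each is found by filtering the list of all candidates as often as it has elements
(`shrink`). Interval ends are only compared with each other, with 0 and with 1, so their binary
notation causes no blow-up (`leBits`).

Machines. Structured stack programs are compiled to `TM2` machines. Data are binary trees in Polish
notation, which is self-delimiting. The class `PTime` is closed under composition, pairing,
branching and folds whose intermediate values stay polynomial; this covers the decision procedures.
The input is parsed by a fold whose state grows by a bounded amount per letter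
(`computable_of_foldr`). -/

namespace StackProg

open Turing Function

variable {K : Type} {Γ : K → Type}

/-- Structured programs acting on a family of stacks. `cond k f` pops stack `k` and continues
according to the popped symbol; `loop k c f` pops stack `k`, and as long as the popped symbol
satisfies `c` runs `f` on it and repeats. -/
inductive Prog {K : Type} (Γ : K → Type) : Type
  | skip : Prog Γ
  | push (k : K) (g : Γ k) : Prog Γ
  | seq (p q : Prog Γ) : Prog Γ
  | cond (k : K) (f : Option (Γ k) → Prog Γ) : Prog Γ
  | loop (k : K) (c : Option (Γ k) → Bool) (f : Option (Γ k) → Prog Γ) : Prog Γ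

/-- `Exec p S S' n`: run on the stacks `S`, the program `p` ends with the stacks `S'` after at
most `n` steps. -/
inductive Exec [DecidableEq K] :
    Prog Γ → (∀ k, List (Γ k)) → (∀ k, List (Γ k)) → ℕ → Prop
  | skip (S) : Exec .skip S S 1
  | push (k g S) : Exec (.push k g) S (update S k (g :: S k)) 1
  | seq {p q S S' S'' m n} : Exec p S S' m → Exec q S' S'' n → Exec (.seq p q) S S'' (m + n)
  | cond {k f S S' n} : Exec (f (S k).head?) (update S k (S k).tail) S' n →
      Exec (.cond k f) S S' (n + 1)
  | loop_done {k c f S} : c (S k).head? = false →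
      Exec (.loop k c f) S (update S k (S k).tail) 1
  | loop_step {k c f S S' S'' m n} : c (S k).head? = true →
      Exec (f (S k).head?) (update S k (S k).tail) S' m → Exec (.loop k c f) S' S'' n →
      Exec (.loop k c f) S S'' (m + n + 1)
  | mono {p S S' m n} : Exec p S S' m → m ≤ n → Exec p S S' n

/-- The program points of a program. -/
def Lbl : Prog Γ → Type
  | .skip => Unit
  | .push _ _ => Unit
  | .seq p q => Lbl p ⊕ Lbl q
  | .cond k f => Option (Σ o : Option (Γ k), Lbl (f o))
  | .loop k _ f => Option (Σ o : Option (Γ k), Lbl (f o))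

/-- The first program point. -/
def entry : (p : Prog Γ) → Lbl p
  | .skip => ()
  | .push _ _ => ()
  | .seq p _ => Sum.inl (entry p)
  | .cond _ _ => none
  | .loop _ _ _ => none

theorem finite_lbl [∀ k, Finite (Γ k)] : ∀ p : Prog Γ, Finite (Lbl p)
  | .skip => inferInstanceAs (Finite Unit)
  | .push _ _ => inferInstanceAs (Finite Unit)
  | .seq p q => by
      have := finite_lbl p
      have := finite_lbl q
      exact inferInstanceAs (Finite (Lbl p ⊕ Lbl q))
  | .cond k f => by
      have := fun o => finite_lbl (f o)
      exact inferInstanceAs (Finite (Option (Σ o : Option (Γ k), Lbl (f o))))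
  | .loop k _ f => by
      have := fun o => finite_lbl (f o)
      exact inferInstanceAs (Finite (Option (Σ o : Option (Γ k), Lbl (f o))))

variable [DecidableEq K]

/-- The internal state of the compiled machine remembers the last symbol popped from each
stack. -/
abbrev Reg (Γ : K → Type) : Type := ∀ k, Option (Γ k)

/-- The statement at a program point of `p`, when the program points of `p` are embedded into
the labels by `e` and `p` exits to the label `x`. -/
def stmt : (p : Prog Γ) → {Λ : Type} → (Lbl p → Λ) → Λ → Lbl p → TM2.Stmt Γ Λ (Reg Γ)
  | .skip, _, _, x, _ => .goto fun _ => x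
  | .push k g, _, _, x, _ => .push k (fun _ => g) (.goto fun _ => x)
  | .seq p q, _, e, _, .inl l => stmt p (fun l => e (.inl l)) (e (.inr (entry q))) l
  | .seq _ q, _, e, x, .inr l => stmt q (fun l => e (.inr l)) x l
  | .cond k f, _, e, _, none =>
      .pop k (fun v o => update v k o) (.goto fun v => e (some ⟨v k, entry (f (v k))⟩))
  | .cond _ f, _, e, x, some ⟨o, l⟩ => stmt (f o) (fun l => e (some ⟨o, l⟩)) x l
  | .loop k c f, _, e, x, none =>
      .pop k (fun v o => update v k o)
        (.goto fun v => if c (v k) then e (some ⟨v k, entry (f (v k))⟩) else x)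
  | .loop _ _ f, _, e, _, some ⟨o, l⟩ => stmt (f o) (fun l => e (some ⟨o, l⟩)) (e none) l

/-- The machine `M` gets from `a` to `b` in at most `n` steps. -/
def Steps {Λ : Type} (M : Λ → TM2.Stmt Γ Λ (Reg Γ)) (n : ℕ) (a b : TM2.Cfg Γ Λ (Reg Γ)) : Prop :=
  ∃ m ≤ n, (flip bind (TM2.step M))^[m] (some a) = some b

theorem Steps.trans {Λ : Type} {M : Λ → TM2.Stmt Γ Λ (Reg Γ)} {m n : ℕ}
    {a b c : TM2.Cfg Γ Λ (Reg Γ)} (h : Steps M m a b) (h' : Steps M n b c) :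
    Steps M (m + n) a c := by
  obtain ⟨i, hi, ei⟩ := h
  obtain ⟨j, hj, ej⟩ := h'
  exact ⟨j + i, by omega, by rw [iterate_add_apply, ei, ej]⟩

theorem Steps.single {Λ : Type} {M : Λ → TM2.Stmt Γ Λ (Reg Γ)} {a b : TM2.Cfg Γ Λ (Reg Γ)}
    (h : TM2.step M a = some b) : Steps M 1 a b :=
  ⟨1, le_rfl, h⟩

/-- Correctness of the compilation, for a program sitting anywhere inside a larger machine: `e`
places its program points and `x` is where control goes afterwards. The final register is only
asserted to exist, because a pop overwrites it before any branch reads it. -/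
theorem Exec.steps {p : Prog Γ} {S S' : ∀ k, List (Γ k)} {n : ℕ} (h : Exec p S S' n) :
    ∀ {Λ : Type} (M : Λ → TM2.Stmt Γ Λ (Reg Γ)) (e : Lbl p → Λ) (x : Λ),
      (∀ l, M (e l) = stmt p e x l) → ∀ v, ∃ v',
        Steps M n ⟨some (e (entry p)), v, S⟩ ⟨some x, v', S'⟩ := by
  induction h with
  | skip S =>
    intro Λ M e x he v
    exact ⟨v, .single (by simp [he, stmt])⟩
  | push k g S =>
    intro Λ M e x he v
    exact ⟨v, .single (by simp [he, stmt])⟩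
  | @seq p q S S' S'' m n _ _ ihp ihq =>
    intro Λ M e x he v
    obtain ⟨v₁, h₁⟩ := ihp M (fun l => e (.inl l)) (e (.inr (entry q))) (fun l => he (.inl l)) v
    obtain ⟨v₂, h₂⟩ := ihq M (fun l => e (.inr l)) x (fun l => he (.inr l)) v₁
    exact ⟨v₂, h₁.trans h₂⟩
  | @cond k f S S' n _ ih =>
    intro Λ M e x he v
    obtain ⟨v₁, h₁⟩ := ih M (fun l => e (some ⟨_, l⟩)) x (fun l => he (some ⟨_, l⟩))
      (update v k (S k).head?)
    refine ⟨v₁, ?_⟩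
    rw [add_comm]
    refine (Steps.single ?_).trans h₁
    have h₀ : M (e none) = _ := he none
    -- The target label depends on the popped symbol through a dependent pair, so the register value
    -- is replaced by an auxiliary equality instead of a rewrite.
    have h₁' : ∀ o, o = (S k).head? → e (some ⟨o, entry (f o)⟩) =
        e (some ⟨(S k).head?, entry (f (S k).head?)⟩) := by rintro _ rfl; rfl
    simpa [entry, h₀, stmt] using h₁' _ (update_self k (S k).head? v)
  | @loop_done k c f S hc =>
    intro Λ M e x he v
    have h₀ : M (e none) = _ := he none
    exact ⟨update v k (S k).head?, .single (by simp [entry, h₀, stmt, hc])⟩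
  | @loop_step k c f S S' S'' m n hc _ _ ih ih' =>
    intro Λ M e x he v
    obtain ⟨v₁, h₁⟩ := ih M (fun l => e (some ⟨_, l⟩)) (e none) (fun l => he (some ⟨_, l⟩))
      (update v k (S k).head?)
    obtain ⟨v₂, h₂⟩ := ih' M e x he v₁
    refine ⟨v₂, ?_⟩
    rw [add_comm]
    refine (Steps.single ?_).trans (h₁.trans h₂)
    have h₀ : M (e none) = _ := he none
    have h₁' : ∀ o, o = (S k).head? → e (some ⟨o, entry (f o)⟩) =
        e (some ⟨(S k).head?, entry (f (S k).head?)⟩) := by rintro _ rfl; rfl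
    simpa [entry, h₀, stmt, hc] using h₁' _ (update_self k (S k).head? v)
  | mono _ hmn ih =>
    intro Λ M e x he v
    obtain ⟨v', i, hi, h⟩ := ih M e x he v
    exact ⟨v', i, hi.trans hmn, h⟩

/-- The machine that runs `p` and halts with a cleared register. -/
noncomputable def machine [Fintype K] [∀ k, Finite (Γ k)] (k₀ k₁ : K) (p : Prog Γ) : FinTM2 :=
  letI := fun k => Fintype.ofFinite (Γ k)
  letI := finite_lbl p
  letI := Fintype.ofFinite (Option (Lbl p))
  { K := K
    k₀ := k₀
    k₁ := k₁
    Γ := Γ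
    Λ := Option (Lbl p)
    main := some (entry p)
    σ := Reg Γ
    initialState := fun _ => none
    m := fun l => match l with
      | none => .load (fun _ _ => none) .halt
      | some l => stmt p some none l }

/-- The stacks all of which are empty but `k`. -/
def single (k : K) (l : List (Γ k)) : ∀ k, List (Γ k) := update (fun _ => []) k l

theorem initList_machine [Fintype K] [∀ k, Finite (Γ k)] (k₀ k₁ : K) (p : Prog Γ)
    (l : List (Γ k₀)) : initList (machine k₀ k₁ p) l =
      ⟨some (some (entry p)), fun _ => none, single k₀ l⟩ := by
  unfold initList
  congr 1
  funext k
  change K at k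
  change dite (k = k₀) _ _ = dite (k = k₀) _ _
  split_ifs with h
  · subst h; rfl
  · exact (dif_neg h).trans (update_of_ne h l fun _ => []).symm

theorem haltList_machine [Fintype K] [∀ k, Finite (Γ k)] (k₀ k₁ : K) (p : Prog Γ)
    (l : List (Γ k₁)) : haltList (machine k₀ k₁ p) l =
      ⟨none, fun _ => none, single k₁ l⟩ := by
  unfold haltList
  congr 1
  funext k
  change K at k
  change dite (k = k₁) _ _ = dite (k = k₁) _ _
  split_ifs with h
  · subst h; rfl
  · exact (dif_neg h).trans (update_of_ne h l fun _ => []).symm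

/-- The time bound is `T + 1`: the extra step is taken at the exit label, which resets the register
as the halting configuration demands. -/
theorem computable_of_exec [Fintype K] [∀ k, Finite (Γ k)] (k₀ k₁ : K) (p : Prog Γ)
    {α β : Type} (ea : α → List (Γ k₀)) (eb : β → List (Γ k₁)) (f : α → β) (T : Polynomial ℕ)
    (h : ∀ a, Exec p (single k₀ (ea a)) (single k₁ (eb (f a))) (T.eval (ea a).length)) :
    Nonempty (TM2ComputableInPolyTime ea eb f) := by
  have key : ∀ a, ∃ m ≤ (T + 1).eval (ea a).length,
      (flip bind (machine k₀ k₁ p).step)^[m] (some (initList (machine k₀ k₁ p) (ea a)))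
        = some (haltList (machine k₀ k₁ p) (eb (f a))) := by
    intro a
    obtain ⟨v', h₁⟩ := (h a).steps (machine k₀ k₁ p).m some none (fun l => rfl) (fun _ => none)
    have h₂ : Steps (machine k₀ k₁ p).m 1 ⟨some none, v', single k₁ (eb (f a))⟩
        ⟨none, fun _ => none, single k₁ (eb (f a))⟩ := .single rfl
    have h₃ := h₁.trans h₂
    obtain ⟨m, hm, e⟩ := h₃
    refine ⟨m, by simpa using hm, ?_⟩
    rw [initList_machine, haltList_machine]
    exact e
  choose m hm e using key
  exact ⟨{ tm := machine k₀ k₁ p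
           inputAlphabet := Equiv.refl _
           outputAlphabet := Equiv.refl _
           time := T + 1
           outputsFun := fun a =>
            { steps := m a
              evals_in_steps := by
                have h₁ : List.map (Equiv.refl (Γ k₀)).invFun (ea a) = ea a := List.map_id _
                have h₂ : List.map (Equiv.refl (Γ k₁)).invFun (eb (f a)) = eb (f a) :=
                  List.map_id _
                exact (congrArg (fun l => (flip bind (machine k₀ k₁ p).step)^[m a]
                  (some (initList (machine k₀ k₁ p) l))) h₁).trans ((e a).trans
                  (congrArg (fun l => some (haltList (machine k₀ k₁ p) l)) h₂.symm))
              steps_le_m := hm a } }⟩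

end StackProg


/-! ### Tree data on a stack and the basic programs -/

namespace StackProg

open Turing Function

/-- The five stacks of bits: the main stack, two auxiliary ones, a counter and the output. -/
inductive Work
  | m | a | b | c | o
  deriving DecidableEq

/-- The stacks: the input, its reversal, and the stacks of bits. -/
inductive Stack
  | inp | rev
  | work (w : Work)
  deriving DecidableEq

instance : Fintype Work :=
  ⟨{.m, .a, .b, .c, .o}, fun w => by cases w <;> decide⟩

instance : Fintype Stack :=
  ⟨insert .inp (insert .rev (Finset.univ.image .work)), fun k => by cases k <;> simp⟩

/-- The symbols of the stacks. -/
@[reducible] def Cell : Stack → Type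
  | .inp => Unordered.Letter
  | .rev => Unordered.Letter
  | .work _ => Bool

/-- The contents of all stacks. -/
def store (i r : List Unordered.Letter) (m a b c o : List Bool) : ∀ k, List (Cell k)
  | .inp => i
  | .rev => r
  | .work .m => m
  | .work .a => a
  | .work .b => b
  | .work .c => c
  | .work .o => o

/-- The contents of the stacks while the input and output stacks are empty. -/
abbrev st (r : List Unordered.Letter) (m a b c : List Bool) : ∀ k, List (Cell k) :=
  store [] r m a b c []

section update

variable (i r : List Unordered.Letter) (m a b c o x : List Bool) (y : List Unordered.Letter)

theorem store_inp : update (store i r m a b c o) .inp y = store y r m a b c o := by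
  funext k; rcases k with _ | _ | _ | _ | _ | _ | _ <;> rfl

theorem store_rev : update (store i r m a b c o) .rev y = store i y m a b c o := by
  funext k; rcases k with _ | _ | _ | _ | _ | _ | _ <;> rfl

theorem store_m : update (store i r m a b c o) (.work .m) x = store i r x a b c o := by
  funext k; rcases k with _ | _ | _ | _ | _ | _ | _ <;> rfl

theorem store_a : update (store i r m a b c o) (.work .a) x = store i r m x b c o := by
  funext k; rcases k with _ | _ | _ | _ | _ | _ | _ <;> rfl

theorem store_b : update (store i r m a b c o) (.work .b) x = store i r m a x c o := by
  funext k; rcases k with _ | _ | _ | _ | _ | _ | _ <;> rfl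

theorem store_c : update (store i r m a b c o) (.work .c) x = store i r m a b x o := by
  funext k; rcases k with _ | _ | _ | _ | _ | _ | _ <;> rfl

theorem store_o : update (store i r m a b c o) (.work .o) x = store i r m a b c x := by
  funext k; rcases k with _ | _ | _ | _ | _ | _ | _ <;> rfl

end update

/-- Binary trees. -/
inductive Data
  | nil : Data
  | cons (x y : Data) : Data

/-- The number of nodes. -/
def Data.size : Data → ℕ
  | .nil => 1
  | .cons x y => 1 + x.size + y.size

/-- The word in Polish notation for a tree. -/
def Data.word : Data → List Bool
  | .nil => [false]
  | .cons x y => true :: (x.word ++ y.word)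

theorem Data.length_word : ∀ x : Data, x.word.length = x.size
  | .nil => rfl
  | .cons x y => by simp [word, size, length_word x, length_word y]; omega

variable {r : List Unordered.Letter} {m a b c : List Bool}

theorem Exec.congr_right {p : Prog Cell} {S S' S'' : ∀ k, List (Cell k)} {n : ℕ}
    (h : Exec p S S' n) (e : S' = S'') : Exec p S S'' n := e ▸ h

theorem Exec.congr_left {p : Prog Cell} {S S' S'' : ∀ k, List (Cell k)} {n : ℕ}
    (h : Exec p S S' n) (e : S'' = S) : Exec p S'' S' n := e ▸ h

/-! ### Single instructions on the work stacks -/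

section exec

variable {S : ∀ k, List (Cell k)} {n : ℕ}

theorem exec_push_m (g : Bool) : Exec (.push (.work .m) g) (st r m a b c)
    (st r (g :: m) a b c) 1 :=
  (Exec.push (Γ := Cell) (.work .m) g _).congr_right (store_m ..)

theorem exec_push_a (g : Bool) : Exec (.push (.work .a) g) (st r m a b c)
    (st r m (g :: a) b c) 1 :=
  (Exec.push (Γ := Cell) (.work .a) g _).congr_right (store_a ..)

theorem exec_push_b (g : Bool) : Exec (.push (.work .b) g) (st r m a b c)
    (st r m a (g :: b) c) 1 :=
  (Exec.push (Γ := Cell) (.work .b) g _).congr_right (store_b ..)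

theorem exec_push_c (g : Bool) : Exec (.push (.work .c) g) (st r m a b c)
    (st r m a b (g :: c)) 1 :=
  (Exec.push (Γ := Cell) (.work .c) g _).congr_right (store_c ..)

theorem exec_cond_m {f : Option Bool → Prog Cell} (h : Exec (f m.head?) (st r m.tail a b c) S n) :
    Exec (.cond (.work .m) f) (st r m a b c) S (n + 1) :=
  Exec.cond (Γ := Cell) (k := .work .m) (f := f) (h.congr_left (store_m ..))

theorem exec_loop_a_nil {f : Option Bool → Prog Cell} :
    Exec (.loop (.work .a) Option.isSome f) (st r m [] b c) (st r m [] b c) 1 :=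
  (Exec.loop_done (Γ := Cell) (k := .work .a) (c := Option.isSome) (f := f) rfl).congr_right
    (store_a ..)

theorem exec_loop_a_cons {f : Option Bool → Prog Cell} {g : Bool} {T : ∀ k, List (Cell k)} {k : ℕ}
    (h : Exec (f (some g)) (st r m a b c) T k) (h' : Exec (.loop (.work .a) Option.isSome f) T S n) :
    Exec (.loop (.work .a) Option.isSome f) (st r m (g :: a) b c) S (k + n + 1) :=
  Exec.loop_step (Γ := Cell) (k := .work .a) (c := Option.isSome) (f := f) rfl
    (h.congr_left (store_a ..)) h'

theorem exec_loop_b_nil {f : Option Bool → Prog Cell} :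
    Exec (.loop (.work .b) Option.isSome f) (st r m a [] c) (st r m a [] c) 1 :=
  (Exec.loop_done (Γ := Cell) (k := .work .b) (c := Option.isSome) (f := f) rfl).congr_right
    (store_b ..)

theorem exec_loop_b_cons {f : Option Bool → Prog Cell} {g : Bool} {T : ∀ k, List (Cell k)} {k : ℕ}
    (h : Exec (f (some g)) (st r m a b c) T k) (h' : Exec (.loop (.work .b) Option.isSome f) T S n) :
    Exec (.loop (.work .b) Option.isSome f) (st r m a (g :: b) c) S (k + n + 1) :=
  Exec.loop_step (Γ := Cell) (k := .work .b) (c := Option.isSome) (f := f) rfl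
    (h.congr_left (store_b ..)) h'

theorem exec_loop_c_nil {f : Option Bool → Prog Cell} :
    Exec (.loop (.work .c) Option.isSome f) (st r m a b []) (st r m a b []) 1 :=
  (Exec.loop_done (Γ := Cell) (k := .work .c) (c := Option.isSome) (f := f) rfl).congr_right
    (store_c ..)

theorem exec_loop_c_cons {f : Option Bool → Prog Cell} {g : Bool} {T : ∀ k, List (Cell k)} {k : ℕ}
    (h : Exec (f (some g)) (st r m a b c) T k) (h' : Exec (.loop (.work .c) Option.isSome f) T S n) :
    Exec (.loop (.work .c) Option.isSome f) (st r m a b (g :: c)) S (k + n + 1) :=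
  Exec.loop_step (Γ := Cell) (k := .work .c) (c := Option.isSome) (f := f) rfl
    (h.congr_left (store_c ..)) h'

end exec

/-- Move the topmost tree of the main stack, reversed, to the stack `w`. -/
def move (w : Work) : Prog Cell :=
  .seq (.push (.work .c) true) (.loop (.work .c) Option.isSome fun _ =>
    .cond (.work .m) fun o : Option Bool => match o with
      | some true => .seq (.push (.work w) true)
          (.seq (.push (.work .c) true) (.push (.work .c) true))
      | some false => .push (.work w) false
      | none => .skip)

/-- Polish notation lets the end of a tree be found by counting: the stack `c` holds one mark for
every tree still to be read, a `cons` replaces its mark by two, and a `nil` uses its mark up. -/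
theorem exec_move_a (x : Data) :
    Exec (move .a) (st r (x.word ++ m) a b []) (st r m (x.word.reverse ++ a) b [])
      (5 * x.size + 2) := by
  -- The claim is put in continuation form, prolonging any run of the loop after `x` to one before
  -- `x`. The loop then never has to be cut in the middle, and the two subtrees of a `cons` compose.
  have key : ∀ (x : Data) (m a c : List Bool) (S) (n),
      Exec (.loop (.work .c) Option.isSome fun _ =>
        .cond (.work .m) fun o : Option Bool => match o with
          | some true => .seq (.push (.work .a) true)
              (.seq (.push (.work .c) true) (.push (.work .c) true))
          | some false => .push (.work .a) false
          | none => .skip) (st r m (x.word.reverse ++ a) b c) S n →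
      Exec (.loop (.work .c) Option.isSome fun _ =>
        .cond (.work .m) fun o : Option Bool => match o with
          | some true => .seq (.push (.work .a) true)
              (.seq (.push (.work .c) true) (.push (.work .c) true))
          | some false => .push (.work .a) false
          | none => .skip) (st r (x.word ++ m) a b (true :: c)) S (5 * x.size + n) := by
    intro x
    induction x with
    | nil =>
      intro m a c S n h
      refine (exec_loop_c_cons (exec_cond_m (exec_push_a false)) h).mono ?_
      simp only [Data.size]; omega
    | cons x y ihx ihy =>
      intro m a c S n h
      have h' := ihx (y.word ++ m) (true :: a) (true :: c) S _
        (ihy m (x.word.reverse ++ true :: a) c S n (by simpa [Data.word] using h))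
      refine (exec_loop_c_cons (exec_cond_m ((exec_push_a true).seq
        ((exec_push_c true).seq (exec_push_c true))))
        (by simpa [Data.word] using h')).mono ?_
      simp only [Data.size]; omega
  refine ((exec_push_c true).seq (key x m a [] _ 1 exec_loop_c_nil)).mono ?_
  omega

theorem exec_move_b (x : Data) :
    Exec (move .b) (st r (x.word ++ m) a b []) (st r m a (x.word.reverse ++ b) [])
      (5 * x.size + 2) := by
  have key : ∀ (x : Data) (m b c : List Bool) (S) (n),
      Exec (.loop (.work .c) Option.isSome fun _ =>
        .cond (.work .m) fun o : Option Bool => match o with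
          | some true => .seq (.push (.work .b) true)
              (.seq (.push (.work .c) true) (.push (.work .c) true))
          | some false => .push (.work .b) false
          | none => .skip) (st r m a (x.word.reverse ++ b) c) S n →
      Exec (.loop (.work .c) Option.isSome fun _ =>
        .cond (.work .m) fun o : Option Bool => match o with
          | some true => .seq (.push (.work .b) true)
              (.seq (.push (.work .c) true) (.push (.work .c) true))
          | some false => .push (.work .b) false
          | none => .skip) (st r (x.word ++ m) a b (true :: c)) S (5 * x.size + n) := by
    intro x
    induction x with
    | nil =>
      intro m b c S n h
      refine (exec_loop_c_cons (exec_cond_m (exec_push_b false)) h).mono ?_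
      simp only [Data.size]; omega
    | cons x y ihx ihy =>
      intro m b c S n h
      have h' := ihx (y.word ++ m) (true :: b) (true :: c) S _
        (ihy m (x.word.reverse ++ true :: b) c S n (by simpa [Data.word] using h))
      refine (exec_loop_c_cons (exec_cond_m ((exec_push_b true).seq
        ((exec_push_c true).seq (exec_push_c true))))
        (by simpa [Data.word] using h')).mono ?_
      simp only [Data.size]; omega
  refine ((exec_push_c true).seq (key x m b [] _ 1 exec_loop_c_nil)).mono ?_
  omega

/-- Empty the stack `w`, running `f` on every symbol. -/
def drain (w : Work) (f : Bool → Prog Cell) : Prog Cell :=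
  .loop (.work w) Option.isSome fun o : Option Bool => match o with
    | some g => f g
    | none => .skip

theorem exec_drain_a_m : ∀ a m : List Bool,
    Exec (drain .a fun g => .push (.work .m) g) (st r m a b c) (st r (a.reverse ++ m) [] b c)
      (2 * a.length + 1)
  | [], _ => exec_loop_a_nil
  | g :: a, m => by
    refine (exec_loop_a_cons (exec_push_m g)
      (by simpa [drain] using exec_drain_a_m a (g :: m))).mono ?_
    simp only [List.length_cons]; omega

theorem exec_drain_b_m : ∀ b m : List Bool,
    Exec (drain .b fun g => .push (.work .m) g) (st r m a b c) (st r (b.reverse ++ m) a [] c)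
      (2 * b.length + 1)
  | [], _ => exec_loop_b_nil
  | g :: b, m => by
    refine (exec_loop_b_cons (exec_push_m g)
      (by simpa [drain] using exec_drain_b_m b (g :: m))).mono ?_
    simp only [List.length_cons]; omega

theorem exec_drain_b_a : ∀ b a : List Bool,
    Exec (drain .b fun g => .push (.work .a) g) (st r m a b c) (st r m (b.reverse ++ a) [] c)
      (2 * b.length + 1)
  | [], _ => exec_loop_b_nil
  | g :: b, a => by
    refine (exec_loop_b_cons (exec_push_a g)
      (by simpa [drain] using exec_drain_b_a b (g :: a))).mono ?_
    simp only [List.length_cons]; omega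

theorem exec_drain_a_mb : ∀ a m b : List Bool,
    Exec (drain .a fun g => .seq (.push (.work .m) g) (.push (.work .b) g)) (st r m a b c)
      (st r (a.reverse ++ m) [] (a.reverse ++ b) c) (3 * a.length + 1)
  | [], _, _ => exec_loop_a_nil
  | g :: a, m, b => by
    refine (exec_loop_a_cons ((exec_push_m g).seq (exec_push_b g))
      (by simpa [drain] using exec_drain_a_mb a (g :: m) (g :: b))).mono ?_
    simp only [List.length_cons]; omega

theorem exec_drain_a_skip : ∀ a : List Bool,
    Exec (drain .a fun _ => .skip) (st r m a b c) (st r m [] b c) (2 * a.length + 1)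
  | [] => exec_loop_a_nil
  | g :: a => by
    refine (exec_loop_a_cons (.skip _) (exec_drain_a_skip a)).mono ?_
    simp only [List.length_cons]; omega

/-- Remove the topmost tree. -/
def dropTop : Prog Cell := .seq (move .a) (drain .a fun _ => .skip)

theorem exec_dropTop (x : Data) :
    Exec dropTop (st r (x.word ++ m) [] [] []) (st r m [] [] []) (7 * x.size + 3) := by
  refine ((exec_move_a x).seq (exec_drain_a_skip _)).mono ?_
  simp [Data.length_word]; omega

/-- Duplicate the topmost tree. -/
def dup : Prog Cell :=
  .seq (move .a) (.seq (drain .a fun g => .seq (.push (.work .m) g) (.push (.work .b) g))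
    (.seq (drain .b fun g => .push (.work .a) g) (drain .a fun g => .push (.work .m) g)))

/-- Each transfer reverses the word. Draining `a` restores one copy on the main stack and leaves
another on `b`, which is upright there and must pass through `a` once more to arrive upright. -/
theorem exec_dup (x : Data) :
    Exec dup (st r (x.word ++ m) [] [] []) (st r (x.word ++ (x.word ++ m)) [] [] [])
      (12 * x.size + 5) := by
  have h₁ := exec_drain_a_mb (r := r) (c := []) (x.word.reverse ++ []) m []
  have h₂ := exec_drain_b_a (r := r) (m := x.word ++ m) (c := []) x.word []
  have h₃ := exec_drain_a_m (r := r) (b := []) (c := []) (x.word.reverse ++ []) (x.word ++ m)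
  simp only [List.append_nil, List.reverse_reverse] at h₁ h₂ h₃
  refine ((exec_move_a x).seq ((by simpa using h₁ : Exec _ _ _ _).seq (h₂.seq h₃))).mono ?_
  simp [Data.length_word]; omega

/-- Exchange the two topmost trees. -/
def swap : Prog Cell :=
  .seq (move .a) (.seq (move .b)
    (.seq (drain .a fun g => .push (.work .m) g) (drain .b fun g => .push (.work .m) g)))

theorem exec_swap (x y : Data) :
    Exec swap (st r (x.word ++ (y.word ++ m)) [] [] []) (st r (y.word ++ (x.word ++ m)) [] [] [])
      (7 * (x.size + y.size) + 6) := by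
  have h₁ := exec_drain_a_m (r := r) (b := y.word.reverse ++ []) (c := [])
    (x.word.reverse ++ []) m
  have h₂ := exec_drain_b_m (r := r) (a := []) (c := []) (y.word.reverse ++ []) (x.word ++ m)
  simp only [List.append_nil, List.reverse_reverse] at h₁ h₂
  refine ((exec_move_a x).seq ((exec_move_b y).seq
    ((by simpa using h₁ : Exec _ _ _ _).seq h₂))).mono ?_
  simp [Data.length_word]; omega

/-- Push a word on the main stack, its last letter first. -/
def pushWord : List Bool → Prog Cell
  | [] => .skip
  | g :: l => .seq (pushWord l) (.push (.work .m) g)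

theorem exec_pushWord : ∀ l : List Bool,
    Exec (pushWord l) (st r m a b c) (st r (l ++ m) a b c) (l.length + 1)
  | [] => .skip _
  | g :: l => (exec_pushWord l).seq (exec_push_m g)

end StackProg


/-! ### Functions computable in polynomial time on tree data -/

namespace StackProg

open Turing Function

/-- Types whose elements are represented by binary trees. -/
class Code (α : Type) where
  code : α → Data

export Code (code)

instance : Code Bool := ⟨fun b => cond b (.cons .nil .nil) .nil⟩

instance {α β : Type} [Code α] [Code β] : Code (α × β) := ⟨fun p => .cons (code p.1) (code p.2)⟩

/-- The tree for a list. -/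
def codeList {α : Type} [Code α] : List α → Data
  | [] => .nil
  | x :: l => .cons (code x) (codeList l)

instance {α : Type} [Code α] : Code (List α) := ⟨codeList⟩

/-- The size of the representation of `x`. -/
def len {α : Type} [Code α] (x : α) : ℕ := (code x).size

variable {α β γ δ : Type} [Code α] [Code β] [Code γ] [Code δ]

theorem len_bool_le (b : Bool) : len b ≤ 3 := by cases b <;> simp [len, code, Data.size]

theorem len_pair (x : α) (y : β) : len (x, y) = 1 + len x + len y := rfl

theorem len_nil : len ([] : List α) = 1 := rfl

theorem len_cons (x : α) (l : List α) : len (x :: l) = 1 + len x + len l := rfl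

theorem one_le_len (x : α) : 1 ≤ len x := by
  unfold len
  cases code x <;> simp [Data.size]; omega

theorem len_append (l l' : List α) : len (l ++ l') + 1 = len l + len l' := by
  induction l with
  | nil => simp [len_nil, add_comm]
  | cons x l ih => simp only [List.cons_append, len_cons]; omega

theorem len_reverse (l : List α) : len l.reverse = len l := by
  induction l with
  | nil => rfl
  | cons x l ih =>
    have := len_append l.reverse [x]
    simp only [List.reverse_cons, len_cons, len_nil] at *; omega

theorem length_lt_len (l : List α) : l.length < len l := by
  induction l with
  | nil => simp [len_nil]
  | cons x l ih => simp only [List.length_cons, len_cons]; omega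

theorem len_sublist {l l' : List α} (h : l.Sublist l') : len l ≤ len l' := by
  induction h with
  | slnil => exact le_rfl
  | cons x _ ih => simp only [len_cons]; omega
  | cons_cons x _ ih => simp only [len_cons]; omega

theorem len_le_of_mem {x : α} {l : List α} (h : x ∈ l) : len x ≤ len l := by
  have := len_sublist (List.singleton_sublist.2 h)
  simp only [len_cons, len_nil] at this; omega

/-- Natural coefficients make every polynomial monotone, so size bounds can be substituted into time
bounds. -/
theorem eval_mono (T : Polynomial ℕ) {m n : ℕ} (h : m ≤ n) : T.eval m ≤ T.eval n := by
  simp only [Polynomial.eval_eq_sum_range]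
  gcongr

/-- The program `p` replaces the topmost tree `code x` by `code (f x)` in time `T`. -/
def Computes (p : Prog Cell) (f : α → β) (T : Polynomial ℕ) : Prop :=
  ∀ x, len (f x) ≤ T.eval (len x) ∧ ∀ r m,
    Exec p (st r ((code x).word ++ m) [] [] []) (st r ((code (f x)).word ++ m) [] [] [])
      (T.eval (len x))

/-- The function `f` is computable in polynomial time. -/
@[fun_prop]
def PTime (f : α → β) : Prop := ∃ p T, Computes p f T

namespace PTime

open Polynomial

@[fun_prop]
theorem id : PTime fun x : α => x :=
  ⟨.skip, X + 1, fun x => ⟨by simp, fun r m => (Exec.skip _).mono (by simp)⟩⟩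

@[fun_prop]
theorem comp {g : β → γ} {f : α → β} (hg : PTime g) (hf : PTime f) : PTime fun x => g (f x) := by
  obtain ⟨p, T, hp⟩ := hf
  obtain ⟨q, U, hq⟩ := hg
  refine ⟨.seq p q, T + U.comp T, fun x => ⟨?_, fun r m => ?_⟩⟩
  · have := (hq (f x)).1.trans (eval_mono U (hp x).1)
    simp; omega
  · refine (((hp x).2 r m).seq ((hq (f x)).2 r m)).mono ?_
    simpa using eval_mono U (hp x).1

@[fun_prop]
theorem const (y : β) : PTime fun _ : α => y := by
  refine ⟨.seq dropTop (pushWord (code y).word), 7 * X + C (len y + 4), fun x => ⟨?_, fun r m => ?_⟩⟩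
  · simp; omega
  · refine ((exec_dropTop (code x)).seq (exec_pushWord _)).mono ?_
    simp [Data.length_word, len]; omega

/-- The program that removes the topmost symbol of the main stack. -/
def pop : Prog Cell := .cond (.work .m) fun _ => .skip

theorem exec_pop {r : List Unordered.Letter} (g : Bool) (m a b c : List Bool) :
    Exec pop (st r (g :: m) a b c) (st r m a b c) 2 :=
  exec_cond_m (f := fun _ => .skip) (.skip _)

@[fun_prop]
theorem fst {f : α → β × γ} (hf : PTime f) : PTime fun x => (f x).1 := by
  refine comp (g := Prod.fst) ?_ hf
  refine ⟨.seq pop (.seq swap dropTop), 14 * X + 11, fun x => ⟨?_, fun r m => ?_⟩⟩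
  · obtain ⟨x, y⟩ := x
    simp only [eval_add, eval_mul, eval_X, eval_ofNat, len_pair]; omega
  · obtain ⟨x, y⟩ := x
    have h : (code (x, y)).word ++ m = true :: ((code x).word ++ ((code y).word ++ m)) := by
      simp [code, Data.word]
    rw [h]
    refine ((exec_pop ..).seq ((exec_swap ..).seq (exec_dropTop ..))).mono ?_
    simp only [eval_add, eval_mul, eval_X, eval_ofNat, len_pair]; simp only [len]; omega

@[fun_prop]
theorem snd {f : α → β × γ} (hf : PTime f) : PTime fun x => (f x).2 := by
  refine comp (g := Prod.snd) ?_ hf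
  refine ⟨.seq pop dropTop, 7 * X + 5, fun x => ⟨?_, fun r m => ?_⟩⟩
  · obtain ⟨x, y⟩ := x
    simp only [eval_add, eval_mul, eval_X, eval_ofNat, len_pair]; omega
  · obtain ⟨x, y⟩ := x
    have h : (code (x, y)).word ++ m = true :: ((code x).word ++ ((code y).word ++ m)) := by
      simp [code, Data.word]
    rw [h]
    refine ((exec_pop ..).seq (exec_dropTop ..)).mono ?_
    simp only [eval_add, eval_mul, eval_X, eval_ofNat, len_pair]; simp only [len]; omega

@[fun_prop]
theorem pair {f : α → β} {g : α → γ} (hf : PTime f) (hg : PTime g) :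
    PTime fun x => (f x, g x) := by
  obtain ⟨p, T, hp⟩ := hf
  obtain ⟨q, U, hq⟩ := hg
  -- The final `true` is the `cons` tag that turns the two adjacent trees into a pair. The
  -- coefficients add up the costs of one duplication, two exchanges, `p`, `q` and this push.
  refine ⟨.seq dup (.seq p (.seq swap (.seq q (.seq swap (.push (.work .m) true))))),
    19 * X + 15 * T + 8 * U + 18, fun x => ⟨?_, fun r m => ?_⟩⟩
  · have := (hp x).1
    have := (hq x).1
    simp only [eval_add, eval_mul, eval_X, eval_ofNat, len_pair]; omega
  · have h : (code (f x, g x)).word ++ m =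
        true :: ((code (f x)).word ++ ((code (g x)).word ++ m)) := by
      simp [code, Data.word]
    rw [h]
    refine ((exec_dup ..).seq (((hp x).2 ..).seq ((exec_swap ..).seq (((hq x).2 ..).seq
      ((exec_swap ..).seq (exec_push_m _)))))).mono ?_
    have h₁ := (hp x).1
    have h₂ := (hq x).1
    simp only [eval_add, eval_mul, eval_X, eval_ofNat]
    simp only [len] at *; omega

theorem cons {f : α → β} {g : α → List β} (hf : PTime f) (hg : PTime g) :
    PTime fun x => f x :: g x := by
  obtain ⟨p, T, hp⟩ := hf.pair hg
  exact ⟨p, T, hp⟩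

@[fun_prop]
theorem cond_bool {c : α → Bool} {f g : α → β} (hc : PTime c) (hf : PTime f) (hg : PTime g) :
    PTime fun x => bif c x then f x else g x := by
  obtain ⟨d, V, hd⟩ := hc
  obtain ⟨p, T, hp⟩ := hf
  obtain ⟨q, U, hq⟩ := hg
  -- The first letter of the code already decides the truth value. The code of `true` has three
  -- letters, hence two further pops in that branch.
  refine ⟨.seq dup (.seq d (.cond (.work .m) fun o : Option Bool => match o with
    | some true => .seq pop (.seq pop p)
    | _ => q)), 12 * X + V + T + U + 10, fun x => ⟨?_, fun r m => ?_⟩⟩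
  · have := (hp x).1
    have := (hq x).1
    cases h : c x <;> simp only [h, cond_true, cond_false] <;> simp <;> omega
  · refine Exec.mono (n := _) (m := (12 * len x + 5) + (V.eval (len x) +
      (((2 + (2 + T.eval (len x))) + U.eval (len x)) + 1))) ?_ (by simp; omega)
    refine (exec_dup ..).seq (((hd x).2 ..).seq (exec_cond_m
      (n := (2 + (2 + T.eval (len x))) + U.eval (len x)) ?_))
    beta_reduce
    generalize c x = b
    cases b
    · refine ((hq x).2 r m).mono ?_
      omega
    · refine ((exec_pop ..).seq ((exec_pop ..).seq ((hp x).2 r m))).mono ?_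
      omega

@[fun_prop]
theorem not {f : α → Bool} (hf : PTime f) : PTime fun x => !f x := by
  have : PTime fun x => bif f x then false else true := by fun_prop
  convert this using 2 with x
  cases f x <;> rfl

@[fun_prop]
theorem and {f g : α → Bool} (hf : PTime f) (hg : PTime g) : PTime fun x => f x && g x := by
  have : PTime fun x => bif f x then g x else false := by fun_prop
  convert this using 2 with x
  cases f x <;> rfl

@[fun_prop]
theorem or {f g : α → Bool} (hf : PTime f) (hg : PTime g) : PTime fun x => f x || g x := by
  have : PTime fun x => bif f x then true else g x := by fun_prop
  convert this using 2 with x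
  cases f x <;> rfl

@[fun_prop]
theorem tail {f : α → List β} (hf : PTime f) : PTime fun x => (f x).tail := by
  refine comp (g := List.tail) ?_ hf
  refine ⟨.cond (.work .m) fun o : Option Bool => match o with
    | some true => dropTop
    -- The empty list is its own tail, so the letter consumed by the test is put back.
    | _ => .push (.work .m) false, 7 * X + 4, fun l => ?_⟩
  cases l with
  | nil => exact ⟨by simp [len_nil], fun r m => (exec_cond_m (exec_push_m false)).mono (by simp)⟩
  | cons x l =>
    refine ⟨by simp [len_cons]; omega, fun r m => ?_⟩
    have h : (code (x :: l)).word ++ m = true :: ((code x).word ++ ((code l).word ++ m)) := by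
      simp [code, codeList, Data.word]
    rw [h]
    refine (exec_cond_m (exec_dropTop ..)).mono ?_
    simp only [eval_add, eval_mul, eval_X, eval_ofNat, len_cons]; simp only [len]; omega

@[fun_prop]
theorem headD {f : α → List β} (hf : PTime f) (y : β) : PTime fun x => (f x).headD y := by
  refine comp (g := fun l => l.headD y) ?_ hf
  refine ⟨.cond (.work .m) fun o : Option Bool => match o with
    | some true => .seq swap dropTop
    | _ => pushWord (code y).word, 14 * X + C (len y + 10), fun l => ?_⟩
  cases l with
  | nil =>
    refine ⟨by simp; omega, fun r m => (exec_cond_m (exec_pushWord (code y).word)).mono ?_⟩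
    simp [Data.length_word, len]; omega
  | cons x l =>
    refine ⟨by simp [len_cons]; omega, fun r m => ?_⟩
    have h : (code (x :: l)).word ++ m = true :: ((code x).word ++ ((code l).word ++ m)) := by
      simp [code, codeList, Data.word]
    rw [h]
    refine (exec_cond_m ((exec_swap ..).seq (exec_dropTop ..))).mono ?_
    simp only [eval_add, eval_mul, eval_X, eval_ofNat, eval_C, len_cons]; simp only [len]; omega

/-- The body of the loop over a list: the main stack holds an element, the remaining list and
the state. -/
def foldBody (p : Prog Cell) : Prog Cell :=
  .seq swap (.seq (move .a) (.seq (.push (.work .m) true)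
    (.seq (drain .a fun g => .push (.work .m) g) (.seq swap (.seq p swap)))))

/-- The step program expects the pair of element and state on top, but the remaining list separates
the two. The list is parked on `a` while the tag is pushed, then brought below the pair, and finally
returned to the top for the next round. -/
theorem exec_foldBody {p : Prog Cell} {T : Polynomial ℕ} {f : α × β → β} (hp : Computes p f T)
    (x : α) (l : List α) (s : β) (r : List Unordered.Letter) (m : List Bool) {W : ℕ}
    (h₁ : len l ≤ W) (h₂ : len (x, s) ≤ W) (h₃ : len (f (x, s)) ≤ W) :
    Exec (foldBody p) (st r ((code x).word ++ ((code l).word ++ ((code s).word ++ m))) [] [] [])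
      (st r ((code l).word ++ ((code (f (x, s))).word ++ m)) [] [] [])
      (49 * W + T.eval W + 22) := by
  have h := exec_drain_a_m (r := r) (b := []) (c := []) ((code l).word.reverse ++ [])
    (true :: ((code x).word ++ ((code s).word ++ m)))
  simp only [List.append_nil, List.reverse_reverse] at h
  have h' : (code (x, s)).word ++ m = true :: ((code x).word ++ ((code s).word ++ m)) := by
    simp [code, Data.word]
  have h'' := exec_swap (r := r) (m := m) (code l) (code (x, s))
  rw [h'] at h''
  have h₀ := exec_move_a (r := r) (a := []) (b := [])
    (m := (code x).word ++ ((code s).word ++ m)) (code l)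
  rw [List.append_nil] at h₀
  refine ((exec_swap ..).seq (h₀.seq ((exec_push_m true).seq (h.seq (h''.seq
    (((hp (x, s)).2 r ((code l).word ++ m)).seq (exec_swap ..))))))).mono ?_
  have h₄ := eval_mono T h₂
  have h₅ : len x ≤ W := by rw [len_pair] at h₂; omega
  simp only [List.length_reverse, Data.length_word]
  simp only [len] at *
  omega

/-- The loop test reads the list constructor: `true` exposes the next element, and `false` is the
whole code of the empty list, so that only the state remains. The bound `W` must hold at every
prefix, since iterating a polynomial-time step can otherwise blow up the state. -/
theorem exec_foldl {p : Prog Cell} {T : Polynomial ℕ} {f : α × β → β} (hp : Computes p f T)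
    (r : List Unordered.Letter) (m : List Bool) {W : ℕ} : ∀ (l : List α) (s : β), len l ≤ W →
    (∀ l₁ x l₂, l = l₁ ++ x :: l₂ → len (x, l₁.foldl (fun s x => f (x, s)) s) ≤ W ∧
      len ((l₁ ++ [x]).foldl (fun s x => f (x, s)) s) ≤ W) →
    Exec (.loop (.work .m) (fun o : Option Bool => o == some true) fun _ => foldBody p)
      (st r ((code l).word ++ ((code s).word ++ m)) [] [] [])
      (st r ((code (l.foldl (fun s x => f (x, s)) s)).word ++ m) [] [] [])
      (l.length * (49 * W + T.eval W + 23) + 1)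
  | [], s, _, _ => by
    refine ((Exec.loop_done (Γ := Cell) (k := .work .m) (f := fun _ => foldBody p) rfl).congr_right
      (store_m ..)).mono ?_
    simp
  | x :: l, s, h₁, h₂ => by
    have h₃ := h₂ [] x l rfl
    have h₄ : len l ≤ W := by rw [len_cons] at h₁; omega
    have h : (code (x :: l)).word ++ ((code s).word ++ m) =
        true :: ((code x).word ++ ((code l).word ++ ((code s).word ++ m))) := by
      simp [code, codeList, Data.word]
    rw [h]
    refine (Exec.loop_step (Γ := Cell) (k := .work .m) (f := fun _ => foldBody p) rfl
      ((exec_foldBody hp x l s r m h₄ h₃.1 h₃.2).congr_left (store_m ..))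
      (exec_foldl hp r m l (f (x, s)) h₄ ?_)).mono ?_
    · intro l₁ y l₂ e
      exact h₂ (x :: l₁) y l₂ (by simp [e])
    · simp only [List.length_cons, add_mul]
      omega

/-- A left fold is computable in polynomial time if its step is and the intermediate results
have polynomial size. -/
theorem foldl {l : γ → List α} {s : γ → β} {f : γ → β → α → β} (hl : PTime l) (hs : PTime s)
    (hf : PTime fun p : γ × β × α => f p.1 p.2.1 p.2.2) (Q : Polynomial ℕ)
    (hQ : ∀ c l₁ l₂, l c = l₁ ++ l₂ → len (l₁.foldl (f c) (s c)) ≤ Q.eval (len c)) :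
    PTime fun c => (l c).foldl (f c) (s c) := by
  -- The parameter `c` travels with the state, because the step program sees nothing but the pair on
  -- top of the stack.
  have hf' : PTime fun p : α × γ × β => (p.2.1, f p.2.1 p.2.2 p.1) := by
    refine pair (by fun_prop) ?_
    exact hf.comp (f := fun p : α × γ × β => (p.2.1, p.2.2, p.1)) (by fun_prop)
  have hi : PTime fun c => (l c, (c, s c)) := by fun_prop
  obtain ⟨p, T, hp⟩ := hf'
  obtain ⟨q, U, hq⟩ := hi
  have e : ∀ c (l : List α) (t : β),
      l.foldl (fun s x => (s.1, f s.1 s.2 x)) (c, t) = (c, l.foldl (f c) t) := by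
    intro c l
    induction l with
    | nil => intro t; rfl
    | cons x l ih => intro t; simp [ih]
  have key : PTime fun c => (c, (l c).foldl (f c) (s c)) := by
    refine ⟨.seq q (.seq pop
      (.loop (.work .m) (fun o : Option Bool => o == some true) fun _ => foldBody p)),
      -- `X + Q + U + 2` bounds an element together with the parameter and the state; the `2` counts
      -- the two pairing nodes. The leading factor `U` bounds the number of rounds.
      U + U * (49 * (X + Q + U + 2) + T.comp (X + Q + U + 2) + 23) + X + Q + 4,
      fun c => ⟨?_, fun r m => ?_⟩⟩
    · have := hQ c (l c) [] (by simp)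
      simp only [eval_add, eval_X, eval_ofNat, len_pair]
      omega
    · have h₀ := (hq c).1
      simp only [len_pair] at h₀
      refine (((hq c).2 r m).seq (Exec.seq (S' := st r ((code (l c)).word ++
        ((code (c, s c)).word ++ m)) [] [] []) (m := 2)
        (n := (l c).length * (49 * (X + Q + U + 2 : Polynomial ℕ).eval (len c) +
          T.eval ((X + Q + U + 2 : Polynomial ℕ).eval (len c)) + 23) + 1) ?_ ?_)).mono ?_
      · have h : (code (l c, (c, s c))).word ++ m = true :: ((code (l c)).word ++
            ((code (c, s c)).word ++ m)) := by simp [code, Data.word]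
        rw [h]
        exact exec_pop ..
      · have h := exec_foldl hp r m (W := (X + Q + U + 2 : Polynomial ℕ).eval (len c))
          (l c) (c, s c) (by simp; omega) ?_
        · simp only [e] at h
          exact h
        · intro l₁ x l₂ hc
          have h₁ := hQ c l₁ _ hc
          have h₂ := hQ c (l₁ ++ [x]) l₂ (by simp [hc])
          have h₃ : len x ≤ len (l c) := len_le_of_mem (by simp [hc])
          simp only [e, len_pair]
          simp only [eval_add, eval_X, eval_ofNat]
          omega
      · have h₁ := length_lt_len (l c)
        simp only [eval_add, eval_mul, eval_comp, eval_X, eval_ofNat]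
        have h₂ : (l c).length ≤ U.eval (len c) := by omega
        have := Nat.mul_le_mul_right (49 * (len c + Q.eval (len c) + U.eval (len c) + 2) +
          T.eval (len c + Q.eval (len c) + U.eval (len c) + 2) + 23) h₂
        omega
  exact key.snd

end PTime

end StackProg


/-! ### Polynomial-time list operations -/

namespace StackProg

open Polynomial

variable {α β γ : Type} [Code α] [Code β] [Code γ]

namespace PTime

attribute [fun_prop] PTime.cons

/-- The size of a function computable in polynomial time. -/
theorem exists_len_le {f : α → β} (hf : PTime f) : ∃ T : ℕ[X], ∀ x, len (f x) ≤ T.eval (len x) :=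
  let ⟨_, T, h⟩ := hf
  ⟨T, fun x => (h x).1⟩

@[fun_prop]
theorem reverse {l : γ → List α} (hl : PTime l) : PTime fun c => (l c).reverse := by
  obtain ⟨T, hT⟩ := hl.exists_len_le
  have : PTime fun c => (l c).foldl (fun s x => x :: s) [] := by
    refine foldl hl (by fun_prop) (by fun_prop) T fun c l₁ l₂ h => ?_
    refine le_trans ?_ (hT c)
    have : l₁.foldl (fun s x => x :: s) [] = l₁.reverse := by simp
    rw [this, len_reverse, h]
    exact len_sublist (List.sublist_append_left ..)
  convert this using 2 with c
  simp

/-- A right fold is computable in polynomial time if its step is and the intermediate results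
have polynomial size. -/
theorem foldr {l : γ → List α} {s : γ → β} {f : γ → α → β → β} (hl : PTime l) (hs : PTime s)
    (hf : PTime fun p : γ × α × β => f p.1 p.2.1 p.2.2) (Q : ℕ[X])
    (hQ : ∀ c l₁ l₂, l c = l₁ ++ l₂ → len (l₂.foldr (f c) (s c)) ≤ Q.eval (len c)) :
    PTime fun c => (l c).foldr (f c) (s c) := by
  have : PTime fun c => (l c).reverse.foldl (fun s x => f c x s) (s c) := by
    refine foldl hl.reverse hs
      (hf.comp (f := fun p : γ × β × α => (p.1, p.2.2, p.2.1)) (by fun_prop)) Q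
      fun c l₁ l₂ h => ?_
    have := hQ c l₂.reverse l₁.reverse (by rw [← List.reverse_append, ← h, List.reverse_reverse])
    simpa using this
  convert this using 2 with c
  simp

@[fun_prop]
theorem append {l l' : γ → List α} (hl : PTime l) (hl' : PTime l') :
    PTime fun c => l c ++ l' c := by
  obtain ⟨T, hT⟩ := hl.exists_len_le
  obtain ⟨U, hU⟩ := hl'.exists_len_le
  have : PTime fun c => (l c).foldr (fun x s => x :: s) (l' c) := by
    refine foldr hl hl' (by fun_prop) (T + U) fun c l₁ l₂ h => ?_
    have e : l₂.foldr (fun x s => x :: s) (l' c) = l₂ ++ l' c := by simp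
    have h₁ := len_append l₂ (l' c)
    have h₂ : len l₂ ≤ len (l c) := by
      rw [h]; exact len_sublist (List.sublist_append_right ..)
    have h₃ := hT c
    have h₄ := hU c
    rw [e, eval_add]; omega
  convert this using 2 with c
  simp

@[fun_prop]
theorem any {l : γ → List α} {f : γ → α → Bool} (hl : PTime l)
    (hf : PTime fun p : γ × α => f p.1 p.2) : PTime fun c => (l c).any (f c) := by
  have : PTime fun c => (l c).foldr (fun x b => f c x || b) false := by
    refine foldr hl (by fun_prop) ?_ 3 fun c l₁ l₂ h => ?_
    · have := hf.comp (f := fun p : γ × α × Bool => (p.1, p.2.1)) (by fun_prop)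
      fun_prop
    · simpa using len_bool_le _
  convert this using 2 with c
  induction l c <;> simp_all

@[fun_prop]
theorem all {l : γ → List α} {f : γ → α → Bool} (hl : PTime l)
    (hf : PTime fun p : γ × α => f p.1 p.2) : PTime fun c => (l c).all (f c) := by
  have : PTime fun c => !(l c).any fun x => !f c x := by fun_prop
  convert this using 2 with c
  simp [List.all_eq_not_any_not]

@[fun_prop]
theorem flatMap {l : γ → List α} {f : γ → α → List β} (hl : PTime l)
    (hf : PTime fun p : γ × α => f p.1 p.2) : PTime fun c => (l c).flatMap (f c) := by
  obtain ⟨T, hT⟩ := hl.exists_len_le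
  obtain ⟨U, hU⟩ := hf.exists_len_le
  have : PTime fun c => (l c).foldr (fun x s => f c x ++ s) [] := by
    refine foldr hl (by fun_prop) ?_ (T * U.comp (1 + X + T) + 1) fun c l₁ l₂ h => ?_
    · have := hf.comp (f := fun p : γ × α × List β => (p.1, p.2.1)) (by fun_prop)
      fun_prop
    -- Every block is the image of an element no longer than the list, so the blocks share one size
    -- bound and their total size is at most the number of elements times that bound, plus one.
    · have key : ∀ l₃ : List α, (∀ x ∈ l₃, x ∈ l c) →
          len (l₃.foldr (fun x s => f c x ++ s) []) ≤
            l₃.length * U.eval (1 + len c + T.eval (len c)) + 1 := by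
        intro l₃
        induction l₃ with
        | nil => intro _; simp [len_nil]
        | cons x l₃ ih =>
          intro hx
          have h₁ := ih fun y hy => hx y (by simp [hy])
          have h₂ := len_append (f c x) (l₃.foldr (fun x s => f c x ++ s) [])
          have h₃ := hU (c, x)
          have h₄ : len (c, x) ≤ 1 + len c + T.eval (len c) := by
            have := (len_le_of_mem (hx x (by simp))).trans (hT c)
            rw [len_pair]; omega
          have h₅ := eval_mono U h₄
          simp only [List.foldr_cons, List.length_cons, add_mul]
          simp only at h₃
          omega
      refine (key l₂ (by simp +contextual [h])).trans ?_
      have h₁ := length_lt_len (l c)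
      have h₂ := hT c
      have h₃ : l₂.length ≤ T.eval (len c) := by
        rw [h] at h₁ h₂; simp only [List.length_append] at h₁; omega
      simpa using Nat.mul_le_mul_right _ h₃
  convert this using 2 with c
  induction l c <;> simp_all

@[fun_prop]
theorem map {l : γ → List α} {f : γ → α → β} (hl : PTime l)
    (hf : PTime fun p : γ × α => f p.1 p.2) : PTime fun c => (l c).map (f c) := by
  have : PTime fun c => (l c).flatMap fun x => [f c x] := by fun_prop
  convert this using 2 with c
  induction l c <;> simp_all

@[fun_prop]
theorem filter {l : γ → List α} {f : γ → α → Bool} (hl : PTime l)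
    (hf : PTime fun p : γ × α => f p.1 p.2) : PTime fun c => (l c).filter (f c) := by
  have : PTime fun c => (l c).flatMap fun x => bif f c x then [x] else [] := by fun_prop
  convert this using 2 with c
  induction l c with
  | nil => rfl
  | cons x l ih => rw [List.filter_cons, List.flatMap_cons, ← ih]; cases f c x <;> simp

@[fun_prop]
theorem product {l : γ → List α} {l' : γ → List β} (hl : PTime l) (hl' : PTime l') :
    PTime fun c => (l c).product (l' c) := by
  unfold List.product
  fun_prop

end PTime

/-- The largest sublist of `l` all of whose elements satisfy `p` relative to the sublist itself,
computed by repeated filtering (for monotone `p`). -/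
def shrink (p : List α → α → Bool) (l : List α) : List α :=
  l.foldl (fun s _ => s.filter (p s)) l

theorem foldl_filter_sublist {α β : Type} (p : List α → α → Bool) (l : List β) (s : List α) :
    (l.foldl (fun s _ => s.filter (p s)) s).Sublist s := by
  induction l generalizing s with
  | nil => simp
  | cons x l ih => exact (ih _).trans List.filter_sublist

/-- A round of filtering either changes nothing, and then neither does any later one, or removes an
element. As many rounds as elements therefore reach a fixed point; monotonicity of `p` plays no
role. -/
theorem foldl_filter_fixed {α β : Type} (p : List α → α → Bool) (l : List β) (s : List α)
    (h : s.length ≤ l.length) :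
    (l.foldl (fun s _ => s.filter (p s)) s).filter (p (l.foldl (fun s _ => s.filter (p s)) s)) =
      l.foldl (fun s _ => s.filter (p s)) s := by
  induction l generalizing s with
  | nil =>
    have : s = [] := by simpa using h
    simp [this]
  | cons x l ih =>
    by_cases hs : s.filter (p s) = s
    · have : ∀ l : List β, l.foldl (fun s _ => s.filter (p s)) s = s := by
        intro l
        induction l with
        | nil => rfl
        | cons y l ih => rw [List.foldl_cons, hs, ih]
      rw [this, hs]
    · refine ih _ ?_
      have h₁ : (s.filter (p s)).length ≠ s.length := fun e =>
        hs (List.filter_sublist.eq_of_length e)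
      have h₂ := List.length_filter_le (p s) s
      simp only [List.length_cons] at h
      change (s.filter (p s)).length ≤ _
      omega

theorem shrink_subset {α : Type} {p : List α → α → Bool} {l : List α} {x : α}
    (h : x ∈ shrink p l) : x ∈ l :=
  (foldl_filter_sublist p l l).subset h

theorem shrink_fixed {α : Type} {p : List α → α → Bool} {l : List α} {x : α}
    (h : x ∈ shrink p l) : p (shrink p l) x = true := by
  have h' := foldl_filter_fixed p l l le_rfl
  exact List.filter_eq_self.1 h' x h

/-- Coinduction principle: a set contained in the start, and kept by filtering relative to any list
that includes it, survives all rounds. With `shrink_fixed` this identifies greatest fixed points. -/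
theorem subset_shrink {α : Type} {p : List α → α → Bool} {l : List α} {Q : α → Prop}
    (hl : ∀ x, Q x → x ∈ l) (hp : ∀ s, (∀ y, Q y → y ∈ s) → ∀ x, Q x → p s x = true)
    {x : α} (hx : Q x) : x ∈ shrink p l := by
  have : ∀ (l' s : List α), (∀ y, Q y → y ∈ s) → ∀ y, Q y →
      y ∈ l'.foldl (fun s _ => s.filter (p s)) s := by
    intro l'
    induction l' with
    | nil => exact fun s hs => hs
    | cons z l' ih => exact fun s hs => ih _ fun y hy => List.mem_filter.2 ⟨hs y hy, hp s hs y hy⟩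
  exact this l l hl x hx

@[fun_prop]
theorem PTime.shrink {l : γ → List α} {p : γ → List α → α → Bool} (hl : PTime l)
    (hp : PTime fun q : γ × List α × α => p q.1 q.2.1 q.2.2) :
    PTime fun c => shrink (p c) (l c) := by
  obtain ⟨T, hT⟩ := hl.exists_len_le
  refine foldl hl hl ?_ T fun c l₁ l₂ _ =>
    (len_sublist (foldl_filter_sublist (p c) l₁ (l c))).trans (hT c)
  have := hp.comp (f := fun q : (γ × List α × α) × α => (q.1.1, q.1.2.1, q.2)) (by fun_prop)
  exact filter (f := fun q : γ × List α × α => p q.1 q.2.1) (by fun_prop) this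

/-! ### Binary numbers -/

/-- The natural number with the given binary digits, the least significant one first. -/
def value (l : List Bool) : ℕ := l.foldr (fun b n => b.toNat + 2 * n) 0

theorem value_encodePosNum (p : PosNum) : value (Computability.encodePosNum p) = (p : ℕ) := by
  induction p with
  | one => simp [Computability.encodePosNum, value]
  | bit1 p ih => simp_all [Computability.encodePosNum, value]; omega
  | bit0 p ih => simp_all [Computability.encodePosNum, value]; omega

theorem value_encodeNat (n : ℕ) : value (Computability.encodeNat n) = n := by
  unfold Computability.encodeNat
  have h : ((n : Num) : ℕ) = n := Num.to_of_nat n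
  generalize (n : Num) = k at h
  subst h
  cases k with
  | zero => rfl
  | pos p => exact value_encodePosNum p

/-- Comparison of two binary numbers. -/
def leBits (x y : List Bool) : Bool :=
  let s := x.foldl (fun (s : List Bool × Bool) b =>
    (s.1.tail, bif s.1.headD false then (bif b then s.2 else true)
      else (bif b then false else s.2))) (y, true)
  s.1.any (fun b => b) || s.2

@[fun_prop]
theorem PTime.leBits {f g : γ → List Bool} (hf : PTime f) (hg : PTime g) :
    PTime fun c => leBits (f c) (g c) := by
  obtain ⟨T, hT⟩ := hg.exists_len_le
  unfold StackProg.leBits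
  have : PTime fun c => (f c).foldl (fun (s : List Bool × Bool) b =>
      (s.1.tail, bif s.1.headD false then (bif b then s.2 else true)
        else (bif b then false else s.2))) (g c, true) := by
    refine PTime.foldl hf (by fun_prop) (by fun_prop) (T + 4) fun c l₁ l₂ _ => ?_
    have key : ∀ (l : List Bool) (s : List Bool × Bool), len s.1 ≤ T.eval (len c) →
        len (l.foldl (fun (s : List Bool × Bool) b =>
          (s.1.tail, bif s.1.headD false then (bif b then s.2 else true)
            else (bif b then false else s.2))) s) ≤ (T + 4).eval (len c) := by
      intro l
      induction l with
      | nil =>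
        intro s hs
        have := len_bool_le s.2
        simp only [List.foldl_nil, eval_add, eval_ofNat]
        rw [← Prod.mk.eta (p := s), len_pair]; omega
      | cons b l ih => exact fun s hs => ih _ ((len_sublist (List.tail_sublist _)).trans hs)
    exact key l₁ _ (hT c)
  fun_prop

/-- The digits come least significant first, so each later digit overrides the verdict reached so
far unless the two digits agree. Missing digits of `y` count as zeros, and digits of `y` left over
decide the comparison if one of them is set. -/
theorem leBits_iff (x y : List Bool) : leBits x y = true ↔ value x ≤ value y := by
  have h₀ : ∀ y : List Bool, y.any (fun b => b) = true ↔ 0 < value y := by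
    intro y
    induction y with
    | nil => simp [value]
    | cons b y ih => cases b <;> simp_all [value]
  -- Here `q` is the verdict on the lower digits, which matters only if the remaining values are
  -- equal.
  have key : ∀ (x y : List Bool) (q : Bool),
      ((x.foldl (fun (s : List Bool × Bool) b =>
        (s.1.tail, bif s.1.headD false then (bif b then s.2 else true)
          else (bif b then false else s.2))) (y, q)).1.any (fun b => b) = true ∨
      (x.foldl (fun (s : List Bool × Bool) b =>
        (s.1.tail, bif s.1.headD false then (bif b then s.2 else true)
          else (bif b then false else s.2))) (y, q)).2 = true) ↔
      value x < value y ∨ (value x = value y ∧ q = true) := by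
    intro x
    induction x with
    | nil =>
      intro y q
      simp only [List.foldl_nil, h₀]
      simp only [value, List.foldr_nil]
      constructor
      · rintro (h | h)
        · exact .inl h
        · rcases Nat.eq_zero_or_pos (value y) with e | e
          · exact .inr ⟨e.symm, h⟩
          · exact .inl e
      · rintro (h | h)
        · exact .inl h
        · exact .inr h.2
    | cons b x ih =>
      intro y q
      rw [List.foldl_cons, ih]
      have h₁ : value (b :: x) = b.toNat + 2 * value x := rfl
      have h₂ : value y = (y.headD false).toNat + 2 * value y.tail := by cases y <;> simp [value]
      rw [h₁, h₂]
      simp only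
      generalize y.headD false = c
      generalize value y.tail = n
      generalize value x = m
      cases b <;> cases c <;> cases q <;> simp <;> omega
  unfold leBits
  simp only [Bool.or_eq_true]
  rw [key]
  simp [le_iff_lt_or_eq]

/-! ### From polynomial-time functions to machines -/

instance : Finite Unordered.Letter := by
  have h : ∀ x : Unordered.Letter, x ∈ [.bit true, .bit false, .schemaRoot, .rule, .atom,
      .required, .optional, .lower, .upper, .infinity, .orEmpty, .queryRoot, .node, .label,
      .wildcard, .child, .desc, .target] := by
    rintro ((_ | _) | _) <;> simp
  exact Set.finite_univ_iff.1 ((List.finite_toSet _).subset fun x _ => h x)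

instance (k : Stack) : Finite (Cell k) := by
  cases k <;> unfold Cell <;> infer_instance

theorem store_eq_single_inp (w : List Unordered.Letter) :
    single (Γ := Cell) .inp w = store w [] [] [] [] [] [] := by
  funext k; rcases k with _ | _ | _ | _ | _ | _ | _ <;> rfl

theorem store_eq_single_out (l : List Bool) :
    single (Γ := Cell) (.work .o) l = store [] [] [] [] [] [] l := by
  funext k; rcases k with _ | _ | _ | _ | _ | _ | _ <;> rfl

/-- The program that reverses the input. -/
def readInput : Prog Cell :=
  .loop .inp Option.isSome fun o : Option Unordered.Letter => match o with
    | some x => .push .rev x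
    | none => .skip

theorem exec_readInput : ∀ w r : List Unordered.Letter,
    Exec readInput (store w r [] [] [] [] []) (st (w.reverse ++ r) [] [] [] []) (2 * w.length + 1)
  | [], r => (Exec.loop_done (Γ := Cell) (k := .inp) (c := Option.isSome) rfl).congr_right
      (store_inp ..)
  | x :: w, r => by
    refine (Exec.loop_step (Γ := Cell) (k := .inp) (c := Option.isSome) rfl
      (((Exec.push (Γ := Cell) .rev x _).congr_right (store_rev ..)).congr_left (store_inp ..))
      (exec_readInput w (x :: r))).mono ?_ |>.congr_right (by simp)
    simp only [List.length_cons]; omega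

/-- The program that runs `p x` for all letters `x` of the reversed input. -/
def scan (p : Unordered.Letter → Prog Cell) : Prog Cell :=
  .loop .rev Option.isSome fun o : Option Unordered.Letter => match o with
    | some x => p x
    | none => .skip

/-- The reversed input is popped from the top, so this left fold is a right fold over the original
word. One bound `N` serves all letters. -/
theorem exec_scan {p : Unordered.Letter → Prog Cell} {T : Unordered.Letter → ℕ[X]}
    {F : Unordered.Letter → α → α} (hp : ∀ x, Computes (p x) (F x) (T x)) {W N : ℕ}
    (hT : ∀ x, (T x).eval W ≤ N) :
    ∀ (r : List Unordered.Letter) (s : α),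
      (∀ r₁ r₂, r = r₁ ++ r₂ → len (r₁.foldl (fun s x => F x s) s) ≤ W) →
      Exec (scan p) (st r (code s).word [] [] [])
        (st [] (code (r.foldl (fun s x => F x s) s)).word [] [] []) (r.length * (N + 1) + 1)
  | [], s, _ => ((Exec.loop_done (Γ := Cell) (k := .rev) (c := Option.isSome) rfl).congr_right
      (store_rev ..)).mono (by simp)
  | x :: r, s, h => by
    have h₁ := (hp x s).2 r []
    simp only [List.append_nil] at h₁
    have h₂ := (eval_mono (T x) (h [] (x :: r) rfl)).trans (hT x)
    refine (Exec.loop_step (Γ := Cell) (k := .rev) (c := Option.isSome) rfl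
      (h₁.congr_left (store_rev ..))
      (exec_scan hp hT r (F x s) fun r₁ r₂ e => h (x :: r₁) r₂ (by simp [e]))).mono ?_
    simp only [List.length_cons, add_mul, List.foldl_nil] at *
    omega

/-- The program that writes the answer. -/
def writeAnswer : Prog Cell :=
  .cond (.work .m) fun o : Option Bool => match o with
    | some true => .seq PTime.pop (.seq PTime.pop (.push (.work .o) true))
    | _ => .push (.work .o) false

theorem exec_writeAnswer (b : Bool) :
    Exec writeAnswer (st [] (code b).word [] [] []) (store [] [] [] [] [] [] [b]) 6 := by
  cases b
  · exact (exec_cond_m ((Exec.push (Γ := Cell) (.work .o) false _).congr_right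
      (store_o ..))).mono (by omega)
  · exact exec_cond_m ((PTime.exec_pop ..).seq ((PTime.exec_pop ..).seq
      ((Exec.push (Γ := Cell) (.work .o) true _).congr_right (store_o ..))))

/-- A decision problem is solved in polynomial time by a right fold over the input word with
steps computable in polynomial time that increase the size of the state by a constant at most. -/
theorem computable_of_foldr {ι : Type} (enc : ι → List Unordered.Letter) (s₀ : α)
    (F : Unordered.Letter → α → α) (hF : ∀ x, PTime (F x)) (c : ℕ)
    (hc : ∀ x s, len (F x s) ≤ len s + c) {post : α → Bool} (hpost : PTime post) (f : ι → Bool)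
    (hf : ∀ a, f a = post ((enc a).foldr F s₀)) :
    Nonempty (Turing.TM2ComputableInPolyTime enc Computability.encodeBool f) := by
  choose p T hp using hF
  obtain ⟨q, U, hq⟩ := hpost
  have := Fintype.ofFinite Unordered.Letter
  refine computable_of_exec (Γ := Cell) .inp (.work .o) (.seq readInput
    (.seq (pushWord (code s₀).word) (.seq (scan p) (.seq q writeAnswer)))) enc _ f
    (2 * X + 1 + (C (len s₀ + 1) + (X * ((∑ x, T x).comp (C (len s₀) + C c * X) + 1) + 1 +
      (U.comp (C (len s₀) + C c * X) + 6)))) fun a => ?_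
  rw [store_eq_single_inp, store_eq_single_out]
  generalize hw : enc a = w
  -- Additive growth keeps the state linear in the input, so the polynomial cost per letter stays
  -- polynomial in the input. The sum of the `T x` dominates each of them and is available because
  -- there are finitely many letters.
  have hlen : ∀ r : List Unordered.Letter, len (r.foldl (fun s x => F x s) s₀) ≤
      len s₀ + c * r.length := by
    intro r
    induction r using List.reverseRecOn with
    | nil => simp
    | append_singleton r x ih =>
      have := hc x (r.foldl (fun s x => F x s) s₀)
      simp only [List.foldl_append, List.foldl_cons, List.foldl_nil, List.length_append,
        List.length_cons, List.length_nil, mul_add]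
      omega
  have h₁ := exec_readInput w []
  have h₂ := exec_pushWord (r := w.reverse ++ []) (m := []) (a := []) (b := []) (c := [])
    (code s₀).word
  have h₃ := exec_scan (F := F) hp (W := len s₀ + c * w.length)
    (N := (∑ x, T x).eval (len s₀ + c * w.length)) (fun x => by
      rw [eval_finsetSum]
      exact Finset.single_le_sum (f := fun x => (T x).eval (len s₀ + c * w.length))
        (fun _ _ => Nat.zero_le _) (Finset.mem_univ x)) w.reverse s₀ (fun r₁ r₂ e => by
      refine (hlen r₁).trans ?_
      have : w.length = r₁.length + r₂.length := by
        rw [← List.length_reverse, e, List.length_append]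
      rw [this]
      gcongr
      omega)
  have e : w.reverse.foldl (fun s x => F x s) s₀ = w.foldr F s₀ := by simp
  have h₄ := (hq (w.foldr F s₀)).2 [] []
  have h₅ := exec_writeAnswer (post (w.foldr F s₀))
  have h₆ := eval_mono U ((hlen w.reverse).trans_eq (by rw [List.length_reverse]))
  rw [e] at h₃ h₆
  simp only [List.append_nil] at h₁ h₂ h₄
  have h₇ : Computability.encodeBool (f a) = [post (w.foldr F s₀)] := by
    rw [hf, hw]; rfl
  rw [h₇]
  refine (h₁.seq (h₂.seq (h₃.seq (h₄.seq h₅)))).mono ?_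
  simp only [Data.length_word, List.length_reverse, eval_add, eval_mul, eval_X, eval_ofNat,
    eval_one, eval_C, eval_comp]
  simp only [len] at *
  omega

end StackProg


/-! ### Words of interval multiplicity expressions -/

namespace Unordered

variable {A : Type}

/-- Some word of `L` has all its symbols in `P`. -/
def Lang.Has (L : Lang A) (P : A → Prop) : Prop := ∃ w ∈ L, ∀ c ∈ w, P c

/-- The symbol `b` occurs in some word of `L` that has all its symbols in `P`. -/
def Lang.Occurs (L : Lang A) (P : A → Prop) (b : A) : Prop := ∃ w ∈ L, (∀ c ∈ w, P c) ∧ b ∈ w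

/-- Among the words with all symbols in `P` there is one in which all possible symbols occur. -/
def Lang.HasMax (L : Lang A) : Prop :=
  ∀ P, L.Has P → ∃ w ∈ L, (∀ c ∈ w, P c) ∧ ∀ b, L.Occurs P b → b ∈ w

namespace Lang

variable {L : Lang A} {P : A → Prop} {b : A} {I : Interval}

theorem Occurs.has (h : L.Occurs P b) : L.Has P :=
  let ⟨w, hw, h, _⟩ := h
  ⟨w, hw, h⟩

theorem has_concat (Ls : List (Lang A)) : (concat Ls).Has P ↔ ∀ L ∈ Ls, L.Has P := by
  induction Ls with
  | nil => simp [concat, Has]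
  | cons L Ls ih =>
    rw [List.forall_mem_cons, ← ih]
    constructor
    · rintro ⟨_, ⟨u, hu, v, hv, rfl⟩, h⟩
      exact ⟨⟨u, hu, fun c hc => h c (by simp [hc])⟩, ⟨v, hv, fun c hc => h c (by simp [hc])⟩⟩
    · rintro ⟨⟨u, hu, h⟩, ⟨v, hv, h'⟩⟩
      refine ⟨_, ⟨u, hu, v, hv, rfl⟩, fun c hc => ?_⟩
      rcases Multiset.mem_add.1 hc with hc | hc
      exacts [h c hc, h' c hc]

/-- The factors are chosen independently: `b` has to come from one of them, and the others need only
some admissible word. -/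
theorem occurs_concat (Ls : List (Lang A)) :
    (concat Ls).Occurs P b ↔ (∀ L ∈ Ls, L.Has P) ∧ ∃ L ∈ Ls, L.Occurs P b := by
  induction Ls with
  | nil => simp [concat, Occurs]
  | cons L Ls ih =>
    rw [List.forall_mem_cons]
    constructor
    · rintro ⟨_, ⟨u, hu, v, hv, rfl⟩, h, hb⟩
      have h₁ : ∀ c ∈ u, P c := fun c hc => h c (by simp [hc])
      have h₂ : ∀ c ∈ v, P c := fun c hc => h c (by simp [hc])
      refine ⟨⟨⟨u, hu, h₁⟩, (has_concat Ls).1 ⟨v, hv, h₂⟩⟩, ?_⟩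
      rcases Multiset.mem_add.1 hb with hb | hb
      · exact ⟨L, by simp, u, hu, h₁, hb⟩
      · obtain ⟨L', hL', h'⟩ := (ih.1 ⟨v, hv, h₂, hb⟩).2
        exact ⟨L', by simp [hL'], h'⟩
    · rintro ⟨⟨⟨u, hu, h₁⟩, h₂⟩, L', hL', h'⟩
      rcases List.mem_cons.1 hL' with rfl | hL'
      · obtain ⟨v, hv, hvP⟩ := (has_concat Ls).2 h₂
        obtain ⟨u', hu', hP, hb⟩ := h'
        refine ⟨_, ⟨u', hu', v, hv, rfl⟩, fun c hc => ?_, by simp [hb]⟩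
        rcases Multiset.mem_add.1 hc with hc | hc
        exacts [hP c hc, hvP c hc]
      · obtain ⟨v, hv, hP, hb⟩ := ih.2 ⟨h₂, L', hL', h'⟩
        refine ⟨_, ⟨u, hu, v, hv, rfl⟩, fun c hc => ?_, by simp [hb]⟩
        rcases Multiset.mem_add.1 hc with hc | hc
        exacts [h₁ c hc, hP c hc]

theorem hasMax_concat (Ls : List (Lang A)) (h : ∀ L ∈ Ls, L.HasMax) : (concat Ls).HasMax := by
  induction Ls with
  | nil => exact fun P _ => ⟨0, rfl, by simp, by simp [occurs_concat]⟩
  | cons L Ls ih =>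
    intro P hP
    have hP' := (has_concat _).1 hP
    obtain ⟨u, hu, h₁, h₂⟩ := h L (by simp) P (hP' L (by simp))
    obtain ⟨v, hv, h₃, h₄⟩ := ih (fun L hL => h L (by simp [hL])) P
      ((has_concat Ls).2 fun L hL => hP' L (by simp [hL]))
    refine ⟨_, ⟨u, hu, v, hv, rfl⟩, fun c hc => ?_, fun b hb => ?_⟩
    · rcases Multiset.mem_add.1 hc with hc | hc
      exacts [h₁ c hc, h₃ c hc]
    · obtain ⟨h₅, L', hL', h'⟩ := (occurs_concat _).1 hb
      rcases List.mem_cons.1 hL' with rfl | hL'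
      · simp [h₂ b h']
      · have := h₄ b ((occurs_concat Ls).2 ⟨fun L hL => h₅ L (by simp [hL]), L', hL', h'⟩)
        simp [this]

theorem mem_sum_replicate {w : Multiset A} {n : ℕ} {c : A} :
    c ∈ (List.replicate n w).sum ↔ n ≠ 0 ∧ c ∈ w := by
  induction n with
  | zero => simp
  | succ n ih => simp only [List.replicate_succ, List.sum_cons, Multiset.mem_add, ih]; tauto

theorem mem_list_sum {ws : List (Multiset A)} {c : A} : c ∈ ws.sum ↔ ∃ u ∈ ws, c ∈ u := by
  induction ws with
  | nil => simp
  | cons u ws ih => simp [ih]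

theorem replicate_mem_iterate {w : Multiset A} (hw : w ∈ L) {n : ℕ} (h : I.lo ≤ n)
    (h' : (n : ℕ∞) ≤ I.hi) : (List.replicate n w).sum ∈ L.iterate I :=
  .inl ⟨List.replicate n w, fun u hu => by rwa [List.eq_of_mem_replicate hu], by simpa,
    by simpa, rfl⟩

theorem has_iterate : (L.iterate I).Has P ↔
    (I.orEmpty = true ∨ (I.lo : ℕ∞) ≤ I.hi) ∧ (I.orEmpty = false → I.lo ≠ 0 → L.Has P) := by
  constructor
  · rintro ⟨w, ⟨ws, hws, h₁, h₂, rfl⟩ | ⟨h, rfl⟩, hP⟩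
    · refine ⟨.inr (le_trans (by exact_mod_cast h₁) h₂), fun _ h₀ => ?_⟩
      cases ws with
      | nil => simp at h₁; omega
      | cons u ws => exact ⟨u, hws u (by simp), fun c hc => hP c (by simp [hc])⟩
    · simp [h]
  · rintro ⟨h₁, h₂⟩
    by_cases ho : I.orEmpty = true
    · exact ⟨0, .inr ⟨ho, rfl⟩, by simp⟩
    · simp only [Bool.not_eq_true] at ho
      have h₃ : (I.lo : ℕ∞) ≤ I.hi := by simpa [ho] using h₁
      by_cases h₀ : I.lo = 0
      · exact ⟨0, .inl ⟨[], by simp, by simp [h₀], by simp, rfl⟩, by simp⟩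
      · obtain ⟨w, hw, hP⟩ := h₂ ho h₀
        exact ⟨_, replicate_mem_iterate hw le_rfl h₃, fun c hc => hP c (mem_sum_replicate.1 hc).2⟩

theorem max_one_le (h : (I.lo : ℕ∞) ≤ I.hi) (h' : 1 ≤ I.hi) : ((max I.lo 1 : ℕ) : ℕ∞) ≤ I.hi := by
  rcases max_choice I.lo 1 with e | e <;> rw [e]
  exacts [h, by simpa using h']

theorem occurs_iterate : (L.iterate I).Occurs P b ↔
    (I.lo : ℕ∞) ≤ I.hi ∧ 1 ≤ I.hi ∧ L.Occurs P b := by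
  constructor
  · rintro ⟨w, ⟨ws, hws, h₁, h₂, rfl⟩ | ⟨h, rfl⟩, hP, hb⟩
    · obtain ⟨u, hu, hb⟩ := mem_list_sum.1 hb
      refine ⟨le_trans (by exact_mod_cast h₁) h₂, le_trans ?_ h₂, u, hws u hu,
        fun c hc => hP c (mem_list_sum.2 ⟨u, hu, hc⟩), hb⟩
      exact_mod_cast List.length_pos_of_mem hu
    · simp at hb
  · rintro ⟨h₁, h₂, w, hw, hP, hb⟩
    exact ⟨_, replicate_mem_iterate hw (le_max_left _ 1) (max_one_le h₁ h₂),
      fun c hc => hP c (mem_sum_replicate.1 hc).2, mem_sum_replicate.2 ⟨by simp, hb⟩⟩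

/-- A maximal word of `L` is repeated `max lo 1` times, the least admissible positive number. If no
positive repetition is possible, no symbol occurs at all and any admissible word is maximal. -/
theorem hasMax_iterate (h : L.HasMax) : (L.iterate I).HasMax := by
  intro P hP
  by_cases hI : (I.lo : ℕ∞) ≤ I.hi ∧ 1 ≤ I.hi ∧ L.Has P
  · obtain ⟨h₁, h₂, h₃⟩ := hI
    obtain ⟨w, hw, hP, hb⟩ := h P h₃
    exact ⟨_, replicate_mem_iterate hw (le_max_left _ 1) (max_one_le h₁ h₂),
      fun c hc => hP c (mem_sum_replicate.1 hc).2,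
      fun b h => mem_sum_replicate.2 ⟨by simp, hb b (occurs_iterate.1 h).2.2⟩⟩
  · obtain ⟨w, hw, hP⟩ := hP
    refine ⟨w, hw, hP, fun b h => absurd ?_ hI⟩
    obtain ⟨h₁, h₂, h₃⟩ := occurs_iterate.1 h
    exact ⟨h₁, h₂, h₃.has⟩

theorem has_singleton {a : A} : Has {({a} : Multiset A)} P ↔ P a := by simp [Has]

theorem occurs_singleton {a : A} : Occurs {({a} : Multiset A)} P b ↔ P a ∧ a = b := by
  simp [Occurs, eq_comm]

theorem hasMax_singleton {a : A} : HasMax {({a} : Multiset A)} := by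
  intro P hP
  exact ⟨_, rfl, by simpa [Has] using hP, fun b hb => by simp [(occurs_singleton.1 hb).2]⟩

end Lang

theorem Atom.has_lang (B : Atom A) (P : A → Prop) :
    B.lang.Has P ↔ ∀ p ∈ B, p.2 = false → P p.1 := by
  simp only [Atom.lang, Lang.has_concat, List.forall_mem_map, Lang.has_iterate,
    Lang.has_singleton]
  refine forall₂_congr fun p _ => ?_
  cases p.2 <;> simp [Interval.one, Interval.optional]

theorem Atom.occurs_lang (B : Atom A) (P : A → Prop) (b : A) :
    B.lang.Occurs P b ↔ (∀ p ∈ B, p.2 = false → P p.1) ∧ ∃ p ∈ B, P p.1 ∧ p.1 = b := by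
  rw [← Atom.has_lang]
  simp only [Atom.lang, Lang.has_concat, Lang.occurs_concat]
  refine and_congr_right fun _ => ?_
  simp only [List.mem_map, exists_exists_and_eq_and, Lang.occurs_iterate, Lang.occurs_singleton]
  refine exists_congr fun p => and_congr_right fun _ => ?_
  cases p.2 <;> simp [Interval.one, Interval.optional]

theorem Atom.hasMax_lang (B : Atom A) : B.lang.HasMax :=
  Lang.hasMax_concat _ <| by
    simp only [List.forall_mem_map]
    exact fun p _ => Lang.hasMax_iterate Lang.hasMax_singleton

theorem IME.has_lang (E : IME A) (P : A → Prop) : E.lang.Has P ↔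
    ∀ f ∈ E.factors, (f.2.orEmpty = true ∨ (f.2.lo : ℕ∞) ≤ f.2.hi) ∧
      (f.2.orEmpty = false → f.2.lo ≠ 0 → ∀ p ∈ f.1, p.2 = false → P p.1) := by
  simp only [IME.lang, Lang.has_concat, List.forall_mem_map, Lang.has_iterate, Atom.has_lang]

theorem IME.occurs_lang (E : IME A) (P : A → Prop) (b : A) : E.lang.Occurs P b ↔
    E.lang.Has P ∧ ∃ f ∈ E.factors, (f.2.lo : ℕ∞) ≤ f.2.hi ∧ 1 ≤ f.2.hi ∧
      (∀ p ∈ f.1, p.2 = false → P p.1) ∧ ∃ p ∈ f.1, P p.1 ∧ p.1 = b := by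
  simp only [IME.lang, Lang.occurs_concat, Lang.has_concat]
  refine and_congr_right fun _ => ?_
  simp only [List.mem_map, exists_exists_and_eq_and, Lang.occurs_iterate, Atom.occurs_lang]

theorem IME.hasMax_lang (E : IME A) : E.lang.HasMax :=
  Lang.hasMax_concat _ <| by
    simp only [List.forall_mem_map]
    exact fun f _ => Lang.hasMax_iterate f.1.hasMax_lang

/-- Turns the universal condition into the failure of an existential one, which the algorithm tests
by asking for a word avoiding `b`. -/
theorem IME.mem_symbolsForall (E : IME A) (b : A) :
    b ∈ E.symbolsForall ↔ ¬ E.lang.Has (· ≠ b) := by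
  simp only [IME.symbolsForall, Set.mem_ofPred_eq, Lang.Has, not_exists, not_and, not_forall]
  refine forall₂_congr fun w _ => ⟨fun h => ⟨b, h, by simp⟩, ?_⟩
  rintro ⟨c, hc, h⟩
  rwa [← not_not.1 h]

/-- A nonempty language contains a word the symbols of which occur in all words. -/
theorem IME.exists_min (E : IME A) {P : A → Prop} (h : E.lang.Has P) :
    ∃ w ∈ E.lang, ∀ c ∈ w, c ∈ E.symbolsForall := by
  rw [IME.has_lang] at h
  refine (IME.has_lang E (· ∈ E.symbolsForall)).2 fun f hf =>
    ⟨(h f hf).1, fun h₁ h₂ p hp h₃ => ?_⟩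
  rw [IME.mem_symbolsForall, IME.has_lang]
  exact fun h' => (h' f hf).2 h₁ h₂ p hp h₃ rfl

theorem IME.mem_symbolsExists (E : IME A) (b : A) :
    b ∈ E.symbolsExists ↔ E.lang.Occurs (fun _ => True) b := by
  simp [IME.symbolsExists, Lang.Occurs]

end Unordered


/-! ### Finite rooted trees and homomorphisms of twig queries -/

namespace Unordered

open Relation

section rooted

variable {V : Type} [Finite V] {R : V → V → Prop} (h : ∀ v, ¬ TransGen R v v)

include h

theorem wellFounded_of_acyclic : WellFounded R := by
  have : IsTrans V (TransGen R) := ⟨fun _ _ _ => TransGen.trans⟩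
  have : Std.Irrefl (TransGen R) := ⟨h⟩
  exact (Finite.wellFounded_of_trans_of_irrefl (TransGen R)).mono fun _ _ => TransGen.single

theorem wellFounded_flip_of_acyclic : WellFounded (flip R) :=
  wellFounded_of_acyclic fun v hv => h v (transGen_swap.1 hv)

/-- The number of strict descendants works: along an edge, the target itself is lost. -/
theorem exists_rank : ∃ f : V → ℕ, ∀ v w, R v w → f w < f v := by
  classical
  have := Fintype.ofFinite V
  refine ⟨fun v => (Finset.univ.filter (TransGen R v)).card, fun v w hvw => ?_⟩
  refine Finset.card_lt_card ⟨fun u hu => ?_, fun hs => ?_⟩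
  · simp only [Finset.mem_filter, Finset.mem_univ, true_and] at hu ⊢
    exact .head hvw hu
  · have : w ∈ Finset.univ.filter (TransGen R w) := hs (by simpa using .single hvw)
    exact h w (by simpa using this)

/-- Following parents shows that every node descends from the root, so an edge into the root would
close a cycle. -/
theorem not_rel_root {r : V} (hr : ∀ v, v ≠ r → ∃! u, R u v) (u : V) : ¬ R u r := by
  intro hu
  have key : ∀ v, ReflTransGen R r v := by
    intro v
    induction v using (wellFounded_of_acyclic h).induction with
    | _ v ih =>
      by_cases hv : v = r
      · rw [hv]
      · obtain ⟨w, hw, _⟩ := hr v hv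
        exact (ih w hw).tail hw
  exact h r (.tail' (key u) hu)

end rooted

variable {A : Type}

theorem Twig.not_root (q : Twig A) (n : Fin q.size) : (n, q.root) ∉ q.child ∪ q.desc :=
  not_rel_root (R := fun m m' => (m, m') ∈ q.child ∪ q.desc) q.acyclic q.existsUnique_parent n

theorem LabTree.not_child_root (t : LabTree A) (n : t.Node) : ¬ t.child n t.root :=
  let := t.fintypeNode
  not_rel_root t.acyclic t.existsUnique_parent n

/-- A relation between the nodes of a query and those of a graph that is compatible with the
labels and the edges of the query contains a homomorphism. -/
theorem Twig.exists_hom (q : Twig A) {V : Type} (child : V → V → Prop) (lab : V → A) (r : V)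
    (T : Fin q.size → V → Prop) (hr : T q.root r)
    (hl : ∀ n x, T n x → q.lab n = none ∨ q.lab n = some (lab x))
    (hc : ∀ n x, T n x → ∀ n', (n, n') ∈ q.child → ∃ y, child x y ∧ T n' y)
    (hd : ∀ n x, T n x → ∀ n', (n, n') ∈ q.desc → ∃ y, TransGen child x y ∧ T n' y) :
    ∃ f : Fin q.size → V, f q.root = r ∧
      (∀ n n', (n, n') ∈ q.child → child (f n) (f n')) ∧
      (∀ n n', (n, n') ∈ q.desc → TransGen child (f n) (f n')) ∧
      ((∀ n, q.lab n = none ∨ q.lab n = some (lab (f n))) ∧ ∀ n, T n (f n)) := by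
  classical
  have step : ∀ n x, T n x → ∀ n', ∃ y, (n, n') ∈ q.child ∪ q.desc →
      ((n, n') ∈ q.child → child x y) ∧ ((n, n') ∈ q.desc → TransGen child x y) ∧ T n' y := by
    intro n x h n'
    by_cases h₁ : (n, n') ∈ q.child
    · obtain ⟨y, hy, h'⟩ := hc n x h n' h₁
      exact ⟨y, fun _ => ⟨fun _ => hy, fun _ => .single hy, h'⟩⟩
    · by_cases h₂ : (n, n') ∈ q.desc
      · obtain ⟨y, hy, h'⟩ := hd n x h n' h₂
        exact ⟨y, fun _ => ⟨fun h => absurd h h₁, fun _ => hy, h'⟩⟩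
      · exact ⟨x, fun h => by simp [h₁, h₂] at h⟩
  choose next hnext using step
  choose parent hparent _ using fun n (hn : n ≠ q.root) => q.existsUnique_parent n hn
  -- The image of a node is chosen from the image of its unique parent, by well-founded recursion
  -- along the edges; the subtype carries the invariant `T` that makes the next choice possible.
  let F : ∀ n, (∀ m, (m, n) ∈ q.child ∪ q.desc → {x // T m x}) → {x // T n x} := fun n rec =>
    if hn : n = q.root then ⟨r, hn ▸ hr⟩
    else
      let p := rec (parent n hn) (hparent n hn)
      ⟨next _ p.1 p.2 n, (hnext _ p.1 p.2 n (hparent n hn)).2.2⟩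
  have wf := wellFounded_of_acyclic q.acyclic
  let f : ∀ n, {x // T n x} := wf.fix F
  have hf : ∀ n, f n = F n fun m _ => f m := fun n => wf.fix_eq F n
  have edge : ∀ n n', (n, n') ∈ q.child ∪ q.desc →
      ((n, n') ∈ q.child → child (f n).1 (f n').1) ∧
      ((n, n') ∈ q.desc → TransGen child (f n).1 (f n').1) := by
    intro n n' h
    have hn' : n' ≠ q.root := fun e => q.not_root n (e ▸ h)
    have e : parent n' hn' = n :=
      (q.existsUnique_parent n' hn').unique (hparent n' hn') h
    have h₁ : (f n').1 = next _ (f (parent n' hn')).1 (f (parent n' hn')).2 n' := by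
      rw [hf n']; simp only [F, dif_neg hn']
    have h₂ := hnext _ (f (parent n' hn')).1 (f (parent n' hn')).2 n' (hparent n' hn')
    rw [← h₁, e] at h₂
    exact ⟨h₂.1, h₂.2.1⟩
  refine ⟨fun n => (f n).1, ?_, fun n n' h => (edge n n' (by simp [h])).1 h,
    fun n n' h => (edge n n' (by simp [h])).2 h, fun n => hl n _ (f n).2, fun n => (f n).2⟩
  beta_reduce
  rw [hf]; simp [F]

/-! ### Trees that satisfy a schema -/

theorem LabTree.childWord_eq (t : LabTree A) (n : t.Node) (s : Finset t.Node)
    (h : ∀ y, y ∈ s ↔ t.child n y) : t.childWord n = s.val.map t.lab := by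
  let := t.fintypeNode
  let := Classical.decPred (t.child n)
  have : Finset.univ.filter (t.child n) = s := by ext y; simp [h]
  rw [← this]
  rfl

theorem LabTree.exists_finset (t : LabTree A) (n : t.Node) :
    ∃ s : Finset t.Node, ∀ y, y ∈ s ↔ t.child n y := by
  let := t.fintypeNode
  let := Classical.decPred (t.child n)
  exact ⟨Finset.univ.filter (t.child n), by simp⟩

theorem LabTree.mem_childWord (t : LabTree A) (n : t.Node) (b : A) :
    b ∈ t.childWord n ↔ ∃ y, t.child n y ∧ t.lab y = b := by
  obtain ⟨s, hs⟩ := t.exists_finset n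
  simp [t.childWord_eq n s hs, hs]

/-! ### Joining trees under a new root -/

section graft

variable {n : ℕ} (a : A) (t : Fin n → LabTree A)

/-- The child relation of a tree composed of a root and subtrees. -/
inductive GraftChild : Option (Σ i, (t i).Node) → Option (Σ i, (t i).Node) → Prop
  | root (i) : GraftChild none (some ⟨i, (t i).root⟩)
  | sub {i x y} : (t i).child x y → GraftChild (some ⟨i, x⟩) (some ⟨i, y⟩)

theorem graftChild_some {i : Fin n} {x : (t i).Node} {z : Option (Σ i, (t i).Node)} :
    GraftChild t (some ⟨i, x⟩) z ↔ ∃ y, (t i).child x y ∧ z = some ⟨i, y⟩ := by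
  constructor
  · rintro (_ | h)
    exact ⟨_, h, rfl⟩
  · rintro ⟨y, h, rfl⟩
    exact .sub h

theorem transGen_graftChild_some {i : Fin n} {x : (t i).Node} {z : Option (Σ i, (t i).Node)}
    (h : TransGen (GraftChild t) (some ⟨i, x⟩) z) :
    ∃ y, TransGen (t i).child x y ∧ z = some ⟨i, y⟩ := by
  induction h with
  | single h =>
    obtain ⟨y, h, e⟩ := (graftChild_some t).1 h
    exact ⟨y, .single h, e⟩
  | tail _ h ih =>
    obtain ⟨y, hy, rfl⟩ := ih
    obtain ⟨z, h, e⟩ := (graftChild_some t).1 h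
    exact ⟨z, hy.tail h, e⟩

/-- The tree with root label `a` and the subtrees `t i`. -/
def graft : LabTree A where
  Node := Option (Σ i, (t i).Node)
  fintypeNode := by
    letI := fun i => (t i).fintypeNode
    infer_instance
  root := none
  lab x := match x with
    | none => a
    | some ⟨i, x⟩ => (t i).lab x
  child := GraftChild t
  acyclic := by
    rintro (_ | ⟨i, x⟩) h
    · obtain ⟨z, _, h⟩ := TransGen.tail'_iff.1 h
      cases h
    · obtain ⟨y, hy, e⟩ := transGen_graftChild_some t h
      cases e
      exact (t i).acyclic x hy
  existsUnique_parent := by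
    rintro (_ | ⟨i, y⟩) h
    · exact absurd rfl h
    · by_cases hy : y = (t i).root
      · subst hy
        refine ⟨none, .root i, ?_⟩
        rintro m (_ | h)
        · rfl
        · exact absurd h ((t i).not_child_root _)
      · obtain ⟨x, hx, hu⟩ := (t i).existsUnique_parent y hy
        refine ⟨some ⟨i, x⟩, .sub hx, ?_⟩
        rintro m (_ | h)
        · exact absurd rfl hy
        · rw [hu _ h]

theorem childWord_graft_root : (graft a t).childWord none =
    (Finset.univ : Finset (Fin n)).val.map fun i => (t i).lab (t i).root := by
  rw [LabTree.childWord_eq (graft a t) none ((Finset.univ : Finset (Fin n)).map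
    ⟨fun i => (some ⟨i, (t i).root⟩ : Option (Σ i, (t i).Node)), fun i j h => by
      cases h; rfl⟩)]
  · simp only [Finset.map_val, Multiset.map_map]
    rfl
  · intro y
    simp only [Finset.mem_map, Finset.mem_univ, true_and]
    constructor
    · rintro ⟨i, rfl⟩
      exact .root i
    · rintro (i | _)
      exact ⟨i, rfl⟩

theorem childWord_graft_some (i : Fin n) (x : (t i).Node) :
    (graft a t).childWord (some ⟨i, x⟩) = (t i).childWord x := by
  obtain ⟨s, hs⟩ := (t i).exists_finset x
  rw [LabTree.childWord_eq (graft a t) (some ⟨i, x⟩) (s.map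
    ⟨fun y => (some ⟨i, y⟩ : Option (Σ i, (t i).Node)), fun y z h => by cases h; rfl⟩),
    (t i).childWord_eq x s hs]
  · simp only [Finset.map_val, Multiset.map_map]
    rfl
  · intro y
    simp only [Finset.mem_map, hs]
    refine Iff.trans (exists_congr fun z => and_congr_right fun _ => ?_) (graftChild_some t).symm
    exact eq_comm

end graft

/-! ### Productive symbols and the semantic characterizations -/

namespace IMS

variable (S : IMS A)

/-- The symbol `a` labels the root of some tree all nodes of which obey the rules. -/
inductive Productive : A → Prop
  | intro (a : A) (w : Multiset A) (hw : w ∈ (S.rule a).lang) (h : ∀ c ∈ w, Productive c) :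
    Productive a

/-- All nodes of `t` obey the rules. -/
def Obeys (t : LabTree A) : Prop := ∀ n, t.childWord n ∈ (S.rule (t.lab n)).lang

variable {S}

theorem productive_iff {a : A} : S.Productive a ↔ (S.rule a).lang.Has S.Productive :=
  ⟨fun ⟨_, w, hw, h⟩ => ⟨w, hw, h⟩, fun ⟨w, hw, h⟩ => ⟨a, w, hw, h⟩⟩

theorem Obeys.productive {t : LabTree A} (h : S.Obeys t) (n : t.Node) :
    S.Productive (t.lab n) := by
  let := t.fintypeNode
  induction n using (wellFounded_flip_of_acyclic t.acyclic).induction with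
  | _ n ih =>
    refine ⟨_, _, h n, fun c hc => ?_⟩
    obtain ⟨y, hy, rfl⟩ := (t.mem_childWord n c).1 hc
    exact ih y hy

/-- Trees for all symbols of a word of the rule of `a` can be composed to a tree for `a`. -/
theorem exists_graft {a : A} {w : Multiset A} (hw : w ∈ (S.rule a).lang) (Q : LabTree A → Prop)
    (h : ∀ c ∈ w, ∃ t : LabTree A, t.lab t.root = c ∧ S.Obeys t ∧ Q t) :
    ∃ (n : ℕ) (t : Fin n → LabTree A), (∀ i, Q (t i)) ∧ S.Obeys (graft a t) ∧
      (graft a t).childWord none = w := by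
  induction w using Quotient.inductionOn with
  | _ l =>
    -- One subtree per position of the list, not per symbol, so that multiplicities come out right.
    choose t ht using fun i : Fin l.length => h (l.get i) (List.get_mem l i)
    have e : (graft a t).childWord none = (l : Multiset A) := by
      rw [childWord_graft_root]
      simp only [fun i => (ht i).1]
      rw [Fin.univ_val_map, List.ofFn_get]
    refine ⟨_, t, fun i => (ht i).2.2, ?_, e⟩
    rintro (_ | ⟨i, x⟩)
    · rw [e]; exact hw
    · rw [childWord_graft_some]; exact (ht i).2.1 x

theorem Productive.exists_tree {a : A} (h : S.Productive a) :
    ∃ t : LabTree A, t.lab t.root = a ∧ S.Obeys t := by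
  induction h with
  | intro a w hw _ ih =>
    obtain ⟨n, t, _, h, _⟩ := exists_graft hw (fun _ => True) fun c hc =>
      let ⟨t, h, h'⟩ := ih c hc
      ⟨t, h, h', trivial⟩
    exact ⟨graft a t, rfl, h⟩

theorem satisfiable_iff : S.Satisfiable ↔ S.Productive S.root := by
  constructor
  · rintro ⟨t, h, h'⟩
    exact h ▸ Obeys.productive h' t.root
  · intro h
    obtain ⟨t, h, h'⟩ := h.exists_tree
    exact ⟨t, h, h'⟩

variable (S) in
/-- The dependency graph with an edge `(a, b)` iff `b` occurs below `a` in some tree obeying the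
rules. -/
def prunedGraph : DepGraph A := ⟨S.root, fun a b => (S.rule a).lang.Occurs S.Productive b⟩

variable (S) in
/-- All sequences of labels of length at most `N` that the pruned graph admits below the label of
`x` do occur below `x`. -/
def Full (t : LabTree A) : ℕ → t.Node → Prop
  | 0, _ => True
  | N + 1, x => ∀ b, S.prunedGraph.edge (t.lab x) b → ∃ y, t.child x y ∧ t.lab y = b ∧ Full t N y

theorem Full.of_succ {t : LabTree A} {N : ℕ} {x : t.Node} (h : S.Full t (N + 1) x) :
    S.Full t N x := by
  induction N generalizing x with
  | zero => trivial
  | succ N ih =>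
    intro b hb
    obtain ⟨y, hy, hl, h⟩ := h b hb
    exact ⟨y, hy, hl, ih h⟩

theorem Full.mono {t : LabTree A} {M N : ℕ} {x : t.Node} (h : S.Full t N x) (hMN : M ≤ N) :
    S.Full t M x := by
  induction hMN with
  | refl => exact h
  | step _ ih => exact ih h.of_succ

theorem Full.graft {n : ℕ} {a : A} {t : Fin n → LabTree A} {N : ℕ} {i : Fin n} {x : (t i).Node}
    (h : S.Full (t i) N x) : S.Full (graft a t) N (some ⟨i, x⟩) := by
  induction N generalizing x with
  | zero => trivial
  | succ N ih =>
    intro b hb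
    obtain ⟨y, hy, hl, h⟩ := h b hb
    exact ⟨some ⟨i, y⟩, .sub hy, hl, ih h⟩

/-- The root is expanded by a maximal word over the productive symbols, so all pruned edges from it
are realized simultaneously; each child then receives a tree that is full to depth one less. -/
theorem Productive.exists_full {a : A} (h : S.Productive a) (N : ℕ) :
    ∃ t : LabTree A, t.lab t.root = a ∧ S.Obeys t ∧ S.Full t N t.root := by
  induction N generalizing a with
  | zero =>
    obtain ⟨t, h, h'⟩ := h.exists_tree
    exact ⟨t, h, h', trivial⟩
  | succ N ih =>
    obtain ⟨w, hw, hP, hm⟩ := (S.rule a).hasMax_lang _ (productive_iff.1 h)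
    obtain ⟨n, t, hQ, h, e⟩ := exists_graft hw (fun t => S.Full t N t.root) fun c hc => ih (hP c hc)
    refine ⟨Unordered.graft a t, rfl, h, fun b hb => ?_⟩
    have : b ∈ (Unordered.graft a t).childWord none := by
      rw [e]; exact hm b hb
    obtain ⟨y, hy, hl⟩ := (LabTree.mem_childWord _ _ _).1 this
    refine ⟨y, hy, hl, ?_⟩
    obtain ⟨i⟩ := hy
    exact (hQ i).graft

/-- `l` is the length of a path in the graph: following it uses up `l` levels of fullness. It is
chosen before the tree, so the depth needed for a whole query can be fixed in advance. -/
theorem exists_path {a b : A} (h : TransGen S.prunedGraph.edge a b) : ∃ l, ∀ (t : LabTree A) N x,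
    t.lab x = a → S.Full t (N + l) x →
      ∃ y, TransGen t.child x y ∧ t.lab y = b ∧ S.Full t N y := by
  induction h with
  | single h =>
    refine ⟨1, fun t N x hx hF => ?_⟩
    obtain ⟨y, hy, h'⟩ := hF _ (hx ▸ h)
    exact ⟨y, .single hy, h'⟩
  | @tail b c _ h ih =>
    obtain ⟨l, ih⟩ := ih
    refine ⟨l + 1, fun t N x hx hF => ?_⟩
    obtain ⟨y, hy, hl, hF⟩ := ih t (N + 1) x hx (by rwa [add_right_comm])
    obtain ⟨z, hz, h'⟩ := hF _ (hl ▸ h)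
    exact ⟨z, hy.tail hz, h'⟩

/-- The child word itself is the witness: all its symbols label nodes of a finite obedient tree and
hence are productive. -/
theorem edge_of_child {t : LabTree A} (h : S.Obeys t) {x y : t.Node} (hxy : t.child x y) :
    S.prunedGraph.edge (t.lab x) (t.lab y) := by
  refine ⟨_, h x, fun c hc => ?_, (t.mem_childWord x _).2 ⟨y, hxy, rfl⟩⟩
  obtain ⟨z, _, rfl⟩ := (t.mem_childWord x c).1 hc
  exact h.productive z

/-- A query is satisfiable by a schema iff it embeds into the pruned dependency graph. -/
theorem sat_iff (q : Twig A) : S.Sat q ↔ S.Productive S.root ∧ S.prunedGraph.Embeds q := by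
  constructor
  · rintro ⟨t, ⟨hr, ht⟩, f, hf, hc, hd, hl⟩
    refine ⟨satisfiable_iff.1 ⟨t, hr, ht⟩, fun n => t.lab (f n), (congrArg t.lab hf).trans hr,
      fun n n' h => edge_of_child ht (hc n n' h), fun n n' h => ?_, hl⟩
    exact (hd n n' h).lift t.lab fun x y => edge_of_child ht
  · rintro ⟨hS, f, hf, hc, hd, hl⟩
    obtain ⟨rank, hrank⟩ := exists_rank q.acyclic
    have hpath : ∃ L, 1 ≤ L ∧ ∀ n n', (n, n') ∈ q.desc → ∀ (t : LabTree A) N x,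
        t.lab x = f n → S.Full t (N + L) x →
          ∃ y, TransGen t.child x y ∧ t.lab y = f n' ∧ S.Full t N y := by
      have : ∀ e : Fin q.size × Fin q.size, ∃ l, e ∈ q.desc → ∀ (t : LabTree A) N x,
          t.lab x = f e.1 → S.Full t (N + l) x →
            ∃ y, TransGen t.child x y ∧ t.lab y = f e.2 ∧ S.Full t N y := by
        intro e
        by_cases he : e ∈ q.desc
        · obtain ⟨l, hl⟩ := exists_path (hd e.1 e.2 he)
          exact ⟨l, fun _ => hl⟩
        · exact ⟨0, fun h => absurd h he⟩
      choose l hl using this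
      -- The sum dominates every path length, and the added 1 covers child edges.
      refine ⟨1 + ∑ e, l e, by omega, fun n n' h t N x hx hF => ?_⟩
      refine hl (n, n') h t N x hx (hF.mono ?_)
      have := Finset.single_le_sum (f := l) (fun _ _ => Nat.zero_le _) (Finset.mem_univ (n, n'))
      omega
    obtain ⟨L, hL, hpath⟩ := hpath
    have hle : ∀ n n', (n, n') ∈ q.child ∪ q.desc → rank n' * L + L ≤ rank n * L := by
      intro n n' h
      rw [← Nat.succ_mul]
      exact Nat.mul_le_mul_right L (hrank n n' h)
    -- Every query edge lowers the rank, which frees at least `L` levels. A query node of rank `ρ`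
    -- is sent to a tree node with `ρ * L` levels left.
    obtain ⟨t, hr, ht, hF⟩ := hS.exists_full (rank q.root * L)
    refine ⟨t, ⟨hr, ht⟩, ?_⟩
    obtain ⟨g, h₁, h₂, h₃, h₄, _⟩ := q.exists_hom t.child t.lab t.root
      (fun n x => t.lab x = f n ∧ S.Full t (rank n * L) x) ⟨hr.trans hf.symm, hF⟩
      (fun n x hx => hx.1 ▸ hl n)
      (fun n x hx n' h => hx.2.mono (M := rank n' * L + 1)
        ((Nat.add_le_add_left hL _).trans (hle n n' (by simp [h]))) _ (hx.1 ▸ hc n n' h))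
      (fun n x hx n' h => hpath n n' h t _ x hx.1 (hx.2.mono (hle n n' (by simp [h]))))
    exact ⟨g, h₁, h₂, h₃, h₄⟩

/-- Every node is expanded by a word with mandatory symbols only, so each tree edge is a universal
edge. -/
theorem Productive.exists_minimal {a : A} (h : S.Productive a) : ∃ t : LabTree A,
    t.lab t.root = a ∧ S.Obeys t ∧ ∀ x y, t.child x y → S.forallGraph.edge (t.lab x) (t.lab y) := by
  induction h with
  | intro a w hw hP ih =>
    obtain ⟨v, hv, hm⟩ := (S.rule a).exists_min (P := fun _ => True) ⟨w, hw, by simp⟩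
    obtain ⟨n, t, hQ, h, e⟩ := exists_graft hv
      (fun t => ∀ x y, t.child x y → S.forallGraph.edge (t.lab x) (t.lab y))
      -- Mandatory symbols also occur in the word `w` that witnesses productivity, which gives
      -- access to the induction hypothesis.
      fun c hc => ih c (hm c hc w hw)
    refine ⟨graft a t, rfl, h, fun x y hxy => ?_⟩
    have hxy' : (graft a t).lab y ∈ (graft a t).childWord x :=
      (LabTree.mem_childWord _ _ _).2 ⟨y, hxy, rfl⟩
    rcases hxy with i | h'
    · rw [e] at hxy'
      exact hm _ hxy'
    · exact hQ _ _ _ h'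

/-- A query is implied by a schema iff the schema is not satisfiable or the query embeds into the
universal dependency graph. -/
theorem implies_iff (q : Twig A) :
    S.Implies q ↔ (S.Productive S.root → S.forallGraph.Embeds q) := by
  constructor
  · intro h hS
    obtain ⟨t, hr, ht, hm⟩ := hS.exists_minimal
    obtain ⟨f, hf, hc, hd, hl⟩ := h t ⟨hr, ht⟩
    exact ⟨fun n => t.lab (f n), (congrArg t.lab hf).trans hr, fun n n' h => hm _ _ (hc n n' h),
      fun n n' h => (hd n n' h).lift t.lab hm, hl⟩
  · intro h t ht
    obtain ⟨f, hf, hc, hd, hl⟩ := h (satisfiable_iff.1 ⟨t, ht⟩)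
    have hedge : ∀ (x : t.Node) b, S.forallGraph.edge (t.lab x) b →
        ∃ y, t.child x y ∧ t.lab y = b := fun x b hb => (t.mem_childWord x b).1 (hb _ (ht.2 x))
    have hpath : ∀ a b, TransGen S.forallGraph.edge a b → ∀ x : t.Node, t.lab x = a →
        ∃ y, TransGen t.child x y ∧ t.lab y = b := by
      intro a b h
      induction h with
      | single h =>
        intro x hx
        obtain ⟨y, hy, h'⟩ := hedge x _ (hx ▸ h)
        exact ⟨y, .single hy, h'⟩
      | tail _ h ih =>
        intro x hx
        obtain ⟨y, hy, rfl⟩ := ih x hx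
        obtain ⟨z, hz, h'⟩ := hedge y _ h
        exact ⟨z, hy.tail hz, h'⟩
    obtain ⟨g, h₁, h₂, h₃, h₄, _⟩ := q.exists_hom t.child t.lab t.root
      (fun n x => t.lab x = f n) (ht.1.trans hf.symm) (fun n x hx => hx ▸ hl n)
      (fun n x hx n' h => hedge x _ (hx ▸ hc n n' h))
      (fun n x hx n' h => hpath _ _ (hd n n' h) x hx)
    exact ⟨g, h₁, h₂, h₃, h₄⟩

/-- Every symbol is productive: one whose language is just the empty word by a single leaf, any
other because it labels a node of a tree of the schema. The restriction to productive symbols is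
then vacuous. -/
theorem Trimmed.prunedGraph_eq (h : S.Trimmed) : S.prunedGraph = S.existsGraph := by
  have hP : ∀ a, S.Productive a := by
    intro a
    by_cases h₀ : (S.rule a).lang = {0}
    · exact ⟨a, 0, by rw [h₀]; rfl, by simp⟩
    · obtain ⟨t, ht, n, rfl⟩ := h a h₀
      exact Obeys.productive ht.2 n
  unfold prunedGraph existsGraph
  congr 1
  funext a b
  rw [IME.mem_symbolsExists]
  simp [Lang.Occurs, hP]

end IMS

end Unordered


/-! ### The algorithm -/

namespace Unordered

open StackProg Relation

/-- A natural number in binary. -/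
abbrev Bits : Type := List Bool

/-- An atom with its interval: symbols and optionality flags, lower end, upper end (the empty list
for `∞`), flag for the empty word. -/
abbrev FactorRep : Type := List (Bits × Bool) × Bits × List Bits × Bool

/-- The symbols with their rules. -/
abbrev RulesRep : Type := List (Bits × List FactorRep)

/-- A node of a query with its label (the empty list for the wildcard). -/
abbrev NodeRep : Type := Bits × List Bits

/-- A binary relation between numbers. -/
abbrev RelRep : Type := List (Bits × Bits)

/-- Equality of binary numbers. -/
def eqBits (x y : Bits) : Bool := leBits x y && leBits y x

/-- Membership of a binary number in a list. -/
def memBits (x : Bits) (l : List Bits) : Bool := l.any (eqBits x)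

/-- Membership of a pair of binary numbers in a list. -/
def memPair (e : Bits × Bits) (l : RelRep) : Bool :=
  l.any fun e' => eqBits e.1 e'.1 && eqBits e.2 e'.2

/-- No symbol required by the atom is in `U`. -/
def avoids (U : List Bits) (B : List (Bits × Bool)) : Bool :=
  B.all fun p => p.2 || !memBits p.1 U

/-- The expression has a word without symbols in `U`. -/
def hasWord (U : List Bits) (E : List FactorRep) : Bool :=
  E.all fun f => (f.2.2.2 || f.2.2.1.all fun u => leBits f.2.1 u) &&
    (f.2.2.2 || leBits f.2.1 [] || avoids U f.1)

/-- The unproductive symbols. -/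
def unproductive (R : RulesRep) : List Bits :=
  shrink (fun U a => !R.any fun r => eqBits r.1 a && hasWord U r.2) (R.map fun r => r.1)

/-- The symbol `b` occurs in a word of the expression without symbols in `U`. -/
def occursIn (U : List Bits) (E : List FactorRep) (b : Bits) : Bool :=
  hasWord U E && E.any fun f => f.2.2.1.all (fun u => leBits f.2.1 u && leBits [true] u) &&
    avoids U f.1 && f.1.any fun p => !memBits p.1 U && eqBits p.1 b

/-- The pairs of symbols with the property `p`. -/
def pairs (l : List Bits) (p : Bits → Bits → Bool) : RelRep :=
  (l.product l).filter fun e => p e.1 e.2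

/-- The edges of the pruned existential dependency graph. -/
def prunedEdges (R : RulesRep) (U : List Bits) : RelRep :=
  pairs (R.map fun r => r.1) fun a b => R.any fun r => eqBits r.1 a && occursIn U r.2 b

/-- The edges of the universal dependency graph. -/
def forallEdges (R : RulesRep) : RelRep :=
  pairs (R.map fun r => r.1) fun a b => R.any fun r => eqBits r.1 a && !hasWord [b] r.2

/-- The symbols that are not reachable from `a`. -/
def unreachable (E : RelRep) (l : List Bits) (a : Bits) : List Bits :=
  shrink (fun N b => !E.any fun e => eqBits e.2 b && (eqBits e.1 a || !memBits e.1 N)) l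

/-- The transitive closure. -/
def closure (E : RelRep) (l : List Bits) : RelRep :=
  pairs l fun a b => !memBits b (unreachable E l a)

/-- All edges of `E` that leave the node `x.1` can be followed from the symbol `x.2` along `G`. -/
def edgesOk (E G : RelRep) (T : List (NodeRep × Bits)) (x : NodeRep × Bits) : Bool :=
  E.all fun e => !eqBits e.1 x.1.1 || T.any fun y => eqBits y.1.1 e.2 && memPair (x.2, y.2) G

/-- The pairs of a node of the query and a symbol such that the subquery at the node can be
embedded at the symbol. -/
def matching (N : List NodeRep) (c d G H : RelRep) (l : List Bits) : List (NodeRep × Bits) :=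
  shrink (fun T x => x.1.2.all (fun a => eqBits a x.2) && edgesOk c G T x && edgesOk d H T x)
    (N.product l)

/-- A schema (root and rules) and a query (root, nodes, child edges and descendant edges). -/
abbrev InstanceRep : Type := (Bits × RulesRep) × Bits × List NodeRep × RelRep × RelRep

/-- The query embeds into the graph with the edges `G`. -/
def embeds (x : InstanceRep) (G : RelRep) : Bool :=
  (matching x.2.2.1 x.2.2.2.1 x.2.2.2.2 G (closure G (x.1.2.map fun r => r.1))
    (x.1.2.map fun r => r.1)).any fun y => eqBits y.1.1 x.2.1 && eqBits y.2 x.1.1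

/-- The decision procedure for satisfiability. -/
def decideSat (x : InstanceRep) : Bool :=
  !memBits x.1.1 (unproductive x.1.2) && embeds x (prunedEdges x.1.2 (unproductive x.1.2))

/-- The decision procedure for implication. -/
def decideImpl (x : InstanceRep) : Bool :=
  memBits x.1.1 (unproductive x.1.2) || embeds x (forallEdges x.1.2)

/-! ### The decision procedures are polynomial-time -/

section ptime

variable {γ : Type} [Code γ]

@[fun_prop]
theorem PTime.eqBits {f g : γ → Bits} (hf : PTime f) (hg : PTime g) :
    PTime fun c => eqBits (f c) (g c) := by
  unfold Unordered.eqBits; fun_prop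

@[fun_prop]
theorem PTime.memBits {f : γ → Bits} {g : γ → List Bits} (hf : PTime f) (hg : PTime g) :
    PTime fun c => memBits (f c) (g c) := by
  unfold Unordered.memBits; fun_prop

@[fun_prop]
theorem PTime.memPair {f : γ → Bits × Bits} {g : γ → RelRep} (hf : PTime f) (hg : PTime g) :
    PTime fun c => memPair (f c) (g c) := by
  unfold Unordered.memPair; fun_prop

@[fun_prop]
theorem PTime.avoids {f : γ → List Bits} {g : γ → List (Bits × Bool)} (hf : PTime f)
    (hg : PTime g) : PTime fun c => avoids (f c) (g c) := by
  unfold Unordered.avoids; fun_prop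

@[fun_prop]
theorem PTime.hasWord {f : γ → List Bits} {g : γ → List FactorRep} (hf : PTime f)
    (hg : PTime g) : PTime fun c => hasWord (f c) (g c) := by
  unfold Unordered.hasWord; fun_prop

@[fun_prop]
theorem PTime.unproductive {f : γ → RulesRep} (hf : PTime f) :
    PTime fun c => unproductive (f c) := by
  unfold Unordered.unproductive; fun_prop

@[fun_prop]
theorem PTime.occursIn {f : γ → List Bits} {g : γ → List FactorRep} {h : γ → Bits}
    (hf : PTime f) (hg : PTime g) (hh : PTime h) :
    PTime fun c => occursIn (f c) (g c) (h c) := by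
  unfold Unordered.occursIn; fun_prop

@[fun_prop]
theorem PTime.pairs {f : γ → List Bits} {p : γ → Bits → Bits → Bool} (hf : PTime f)
    (hp : PTime fun q : γ × Bits × Bits => p q.1 q.2.1 q.2.2) :
    PTime fun c => pairs (f c) (p c) := by
  unfold Unordered.pairs; fun_prop

@[fun_prop]
theorem PTime.prunedEdges {f : γ → RulesRep} {g : γ → List Bits} (hf : PTime f)
    (hg : PTime g) : PTime fun c => prunedEdges (f c) (g c) := by
  unfold Unordered.prunedEdges; fun_prop

@[fun_prop]
theorem PTime.forallEdges {f : γ → RulesRep} (hf : PTime f) :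
    PTime fun c => forallEdges (f c) := by
  unfold Unordered.forallEdges; fun_prop

@[fun_prop]
theorem PTime.unreachable {f : γ → RelRep} {g : γ → List Bits} {h : γ → Bits}
    (hf : PTime f) (hg : PTime g) (hh : PTime h) :
    PTime fun c => unreachable (f c) (g c) (h c) := by
  unfold Unordered.unreachable; fun_prop

@[fun_prop]
theorem PTime.closure {f : γ → RelRep} {g : γ → List Bits}
    (hf : PTime f) (hg : PTime g) : PTime fun c => closure (f c) (g c) := by
  unfold Unordered.closure; fun_prop

@[fun_prop]
theorem PTime.edgesOk {f g : γ → RelRep} {h : γ → List (NodeRep × Bits)} {k : γ → NodeRep × Bits}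
    (hf : PTime f) (hg : PTime g) (hh : PTime h) (hk : PTime k) :
    PTime fun c => edgesOk (f c) (g c) (h c) (k c) := by
  unfold Unordered.edgesOk; fun_prop

@[fun_prop]
theorem PTime.matching {N : γ → List NodeRep} {c d G H : γ → RelRep} {l : γ → List Bits}
    (hN : PTime N) (hc : PTime c) (hd : PTime d) (hG : PTime G) (hH : PTime H) (hl : PTime l) :
    PTime fun x => matching (N x) (c x) (d x) (G x) (H x) (l x) := by
  unfold Unordered.matching; fun_prop

@[fun_prop]
theorem PTime.embeds {f : γ → InstanceRep} {g : γ → RelRep}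
    (hf : PTime f) (hg : PTime g) : PTime fun c => embeds (f c) (g c) := by
  unfold Unordered.embeds; fun_prop

theorem PTime.decideSat : PTime decideSat := by
  unfold Unordered.decideSat; fun_prop

theorem PTime.decideImpl : PTime decideImpl := by
  unfold Unordered.decideImpl; fun_prop

end ptime

/-! ### Correctness of the algorithm -/

section correct

/-- The binary representation of an element of `Fin k`. -/
def rep {k : ℕ} (a : Fin k) : Bits := Computability.encodeNat a

theorem eqBits_iff (x y : Bits) : eqBits x y = true ↔ value x = value y := by
  rw [eqBits, Bool.and_eq_true, leBits_iff, leBits_iff, le_antisymm_iff]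

theorem value_rep {k : ℕ} (a : Fin k) : value (rep a) = a := value_encodeNat a

theorem eqBits_rep {k : ℕ} {a b : Fin k} : eqBits (rep a) (rep b) = true ↔ a = b := by
  rw [eqBits_iff, value_rep, value_rep, Fin.ext_iff]

theorem memBits_of_mem {x : Bits} {l : List Bits} (h : x ∈ l) : memBits x l = true :=
  List.any_eq_true.2 ⟨x, h, (eqBits_iff x x).2 rfl⟩

/-- The list of the binary representations of all elements of `Fin k`. -/
def reps (k : ℕ) : List Bits := (List.finRange k).map rep

theorem mem_reps {k : ℕ} {x : Bits} : x ∈ reps k ↔ ∃ a : Fin k, x = rep a := by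
  simp [reps, eq_comm]

/-- Numbers are compared by value, and among canonical representations equal values mean equal digit
lists. -/
theorem memBits_rep {k : ℕ} {a : Fin k} {l : List Bits} (hl : ∀ x ∈ l, x ∈ reps k) :
    memBits (rep a) l = true ↔ rep a ∈ l := by
  refine ⟨fun h => ?_, memBits_of_mem⟩
  obtain ⟨x, hx, h⟩ := List.any_eq_true.1 h
  obtain ⟨b, rfl⟩ := mem_reps.1 (hl x hx)
  rwa [eqBits_rep.1 h]

/-- The representation of the upper end of an interval. -/
def upperRep : ℕ∞ → List Bits
  | none => []
  | some m => [Computability.encodeNat m]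

/-- The representation of an atom. -/
def atomRep {k : ℕ} (B : Atom (Fin k)) : List (Bits × Bool) := B.map fun p => (rep p.1, p.2)

/-- The representation of an expression. -/
def imeRep {k : ℕ} (E : IME (Fin k)) : List FactorRep :=
  E.factors.map fun f =>
    (atomRep f.1, Computability.encodeNat f.2.lo, upperRep f.2.hi, f.2.orEmpty)

/-- The representation of the rules of a schema. -/
def rulesRep {k : ℕ} (S : IMS (Fin k)) : RulesRep :=
  (List.finRange k).map fun a => (rep a, imeRep (S.rule a))

theorem upperRep_all (p : Bits → Bool) (u : ℕ∞) :
    (upperRep u).all p = true ↔ ∀ m : ℕ, u = m → p (Computability.encodeNat m) = true := by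
  cases u with
  | top => simp only [ENat.top_ne_natCast, IsEmpty.forall_iff, implies_true, iff_true]; rfl
  | coe m =>
    have : upperRep (m : ℕ∞) = [Computability.encodeNat m] := rfl
    simp [this]

theorem le_iff_upperRep (n : ℕ) (u : ℕ∞) : (n : ℕ∞) ≤ u ↔ ∀ m : ℕ, u = m → n ≤ m := by
  cases u with
  | top => simp
  | coe m => simp

variable {k : ℕ} (S : IMS (Fin k))

theorem avoids_iff (U : List Bits) (B : Atom (Fin k)) : avoids U (atomRep B) = true ↔
    ∀ p ∈ B, p.2 = false → memBits (rep p.1) U = false := by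
  simp only [avoids, atomRep, List.all_map, List.all_eq_true, Function.comp_apply,
    Bool.or_eq_true, Bool.not_eq_true']
  refine forall₂_congr fun p _ => ?_
  cases p.2 <;> simp

theorem hasWord_iff (U : List Bits) (E : IME (Fin k)) :
    hasWord U (imeRep E) = true ↔ E.lang.Has fun c => memBits (rep c) U = false := by
  rw [IME.has_lang]
  simp only [hasWord, imeRep, List.all_map, List.all_eq_true, Function.comp_apply]
  refine forall₂_congr fun f _ => ?_
  rw [Bool.and_eq_true, Bool.or_eq_true, Bool.or_eq_true, Bool.or_eq_true, upperRep_all,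
    avoids_iff, leBits_iff]
  simp only [leBits_iff, value_encodeNat, le_iff_upperRep]
  refine and_congr_right fun _ => ?_
  -- The test against the empty digit list is the test for lower end zero.
  have : value [] = 0 := rfl
  rw [this, Nat.le_zero]
  cases f.2.orEmpty <;> simp [or_iff_not_imp_left]

theorem occursIn_iff (U : List Bits) (E : IME (Fin k)) (b : Fin k) :
    occursIn U (imeRep E) (rep b) = true ↔
      E.lang.Occurs (fun c => memBits (rep c) U = false) b := by
  rw [IME.occurs_lang, ← hasWord_iff, occursIn, Bool.and_eq_true]
  refine and_congr_right fun _ => ?_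
  simp only [imeRep, List.any_map, List.any_eq_true, Function.comp_apply]
  refine exists_congr fun f => and_congr_right fun _ => ?_
  rw [Bool.and_eq_true, Bool.and_eq_true, upperRep_all, avoids_iff]
  simp only [leBits_iff, value_encodeNat, Bool.and_eq_true, atomRep, List.any_map,
    List.any_eq_true, Function.comp_apply, Bool.not_eq_true', eqBits_rep]
  have h₁ : value [true] = 1 := rfl
  have h₂ := le_iff_upperRep 1 f.2.hi
  rw [Nat.cast_one] at h₂
  rw [le_iff_upperRep f.2.lo, h₂, h₁, forall₂_and, and_assoc, and_assoc]

theorem rulesRep_any (p : List FactorRep → Bool) (a : Fin k) :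
    ((rulesRep S).any fun r => eqBits r.1 (rep a) && p r.2) = true ↔
      p (imeRep (S.rule a)) = true := by
  simp [rulesRep, eqBits_rep]

theorem map_rulesRep : ((rulesRep S).map fun r => r.1) = reps k := by
  simp [rulesRep, reps]

/-- Productivity is a least fixed point, so its complement is the greatest fixed point that `shrink`
finds. One direction is induction on productivity: the witnessing word would avoid all survivors.
The other is coinduction: a word avoiding a list that includes all unproductive symbols has only
productive symbols. -/
theorem mem_unproductive (a : Fin k) : rep a ∈ unproductive (rulesRep S) ↔ ¬ S.Productive a := by
  have hsub : ∀ x ∈ unproductive (rulesRep S), x ∈ reps k := fun x hx => by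
    rw [← map_rulesRep S]; exact shrink_subset hx
  constructor
  · intro h hP
    induction hP with
    | intro a w hw _ ih =>
      have := shrink_fixed h
      rw [Bool.not_eq_true', ← Bool.not_eq_true, rulesRep_any, hasWord_iff] at this
      refine this ⟨w, hw, fun c hc => ?_⟩
      exact eq_false_of_ne_true fun h' => ih c hc ((memBits_rep hsub).1 h')
  · intro h
    refine subset_shrink (Q := fun x => ∃ a : Fin k, x = rep a ∧ ¬ S.Productive a) ?_ ?_
      ⟨a, rfl, h⟩
    · rintro _ ⟨a, rfl, _⟩
      rw [map_rulesRep]; exact mem_reps.2 ⟨a, rfl⟩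
    · rintro s hs _ ⟨a, rfl, ha⟩
      rw [Bool.not_eq_true', ← Bool.not_eq_true, rulesRep_any, hasWord_iff]
      rintro ⟨w, hw, h⟩
      refine ha ⟨a, w, hw, fun c hc => ?_⟩
      by_contra hc'
      exact absurd (memBits_of_mem (hs _ ⟨c, rfl, hc'⟩)) (Bool.not_eq_true _ ▸ h c hc)

theorem memBits_unproductive (a : Fin k) :
    memBits (rep a) (unproductive (rulesRep S)) = false ↔ S.Productive a := by
  rw [← Bool.not_eq_true, memBits_rep (k := k), mem_unproductive, not_not]
  exact fun x hx => by rw [← map_rulesRep S]; exact shrink_subset hx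

/-- The list `E` represents the relation `R`. -/
def Represents (E : RelRep) (R : Fin k → Fin k → Prop) : Prop :=
  ∀ e, e ∈ E ↔ ∃ a b, e = (rep a, rep b) ∧ R a b

variable {S}

theorem represents_pairs {p : Bits → Bits → Bool} {R : Fin k → Fin k → Prop}
    (h : ∀ a b, p (rep a) (rep b) = true ↔ R a b) : Represents (pairs (reps k) p) R := by
  rintro ⟨x, y⟩
  simp only [pairs, List.mem_filter, List.pair_mem_product, mem_reps, Prod.mk.injEq]
  constructor
  · rintro ⟨⟨⟨a, rfl⟩, b, rfl⟩, h'⟩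
    exact ⟨a, b, ⟨rfl, rfl⟩, (h a b).1 h'⟩
  · rintro ⟨a, b, ⟨rfl, rfl⟩, h'⟩
    exact ⟨⟨⟨a, rfl⟩, b, rfl⟩, (h a b).2 h'⟩

theorem Represents.memPair {E : RelRep} {R : Fin k → Fin k → Prop} (h : Represents E R)
    (a b : Fin k) : memPair (rep a, rep b) E = true ↔ R a b := by
  simp only [Unordered.memPair, List.any_eq_true, Bool.and_eq_true, h _]
  constructor
  · rintro ⟨_, ⟨c, d, rfl, hR⟩, h₁, h₂⟩
    rwa [eqBits_rep.1 h₁, eqBits_rep.1 h₂]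
  · intro hR
    exact ⟨_, ⟨a, b, rfl, hR⟩, eqBits_rep.2 rfl, eqBits_rep.2 rfl⟩

theorem represents_prunedEdges :
    Represents (prunedEdges (rulesRep S) (unproductive (rulesRep S))) S.prunedGraph.edge := by
  unfold prunedEdges
  rw [map_rulesRep]
  refine represents_pairs fun a b => ?_
  rw [rulesRep_any (p := fun E => occursIn _ E (rep b)), occursIn_iff]
  simp only [memBits_unproductive]
  rfl

theorem represents_forallEdges : Represents (forallEdges (rulesRep S)) S.forallGraph.edge := by
  unfold forallEdges
  rw [map_rulesRep]
  refine represents_pairs fun a b => ?_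
  rw [rulesRep_any (p := fun E => !hasWord [rep b] E), Bool.not_eq_true', ← Bool.not_eq_true,
    hasWord_iff]
  refine (not_congr (iff_of_eq (congrArg _ ?_))).trans
    (IME.mem_symbolsForall (S.rule a) b).symm
  funext c
  simp [memBits, ← Bool.not_eq_true, eqBits_rep]

/-- Again the complement of a least fixed point. A path starting at `a` has positive length, so `a`
itself may be unreachable; the filter therefore treats edges leaving `a` separately. -/
theorem mem_unreachable {E : RelRep} {R : Fin k → Fin k → Prop} (h : Represents E R)
    (a b : Fin k) : rep b ∈ unreachable E (reps k) (rep a) ↔ ¬ TransGen R a b := by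
  have hsub : ∀ x ∈ unreachable E (reps k) (rep a), x ∈ reps k := fun x hx => shrink_subset hx
  constructor
  · intro hb hR
    induction hR with
    | single hR =>
      have := shrink_fixed hb
      rw [Bool.not_eq_true', ← Bool.not_eq_true, List.any_eq_true] at this
      exact this ⟨_, (h _).2 ⟨_, _, rfl, hR⟩, by simp [eqBits_rep]⟩
    | tail _ hR ih =>
      have := shrink_fixed hb
      rw [Bool.not_eq_true', ← Bool.not_eq_true, List.any_eq_true] at this
      refine this ⟨_, (h _).2 ⟨_, _, rfl, hR⟩, ?_⟩
      have h' := mt (memBits_rep hsub).1 ih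
      rw [Bool.not_eq_true] at h'
      unfold unreachable at h'
      simp [eqBits_rep, h']
  · intro hb
    refine subset_shrink (Q := fun x => ∃ b : Fin k, x = rep b ∧ ¬ TransGen R a b) ?_ ?_
      ⟨b, rfl, hb⟩
    · rintro _ ⟨b, rfl, _⟩
      exact mem_reps.2 ⟨b, rfl⟩
    · rintro s hs _ ⟨b, rfl, hb⟩
      rw [Bool.not_eq_true', ← Bool.not_eq_true, List.any_eq_true]
      rintro ⟨e, he, h'⟩
      obtain ⟨c, d, rfl, hR⟩ := (h e).1 he
      simp only [Bool.and_eq_true, eqBits_rep, Bool.or_eq_true, Bool.not_eq_true'] at h'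
      obtain ⟨rfl, rfl | hc⟩ := h'
      · exact hb (.single hR)
      · refine hb (.tail ?_ hR)
        by_contra hc'
        simp [memBits_of_mem (hs _ ⟨c, rfl, hc'⟩)] at hc

theorem Represents.closure {E : RelRep} {R : Fin k → Fin k → Prop} (h : Represents E R) :
    Represents (closure E (reps k)) (TransGen R) := by
  refine represents_pairs fun a b => ?_
  rw [Bool.not_eq_true', ← Bool.not_eq_true, memBits_rep (k := k), mem_unreachable h, not_not]
  exact fun x hx => shrink_subset hx

/-- The representation of a node of a query. -/
def nodeRep (q : Twig (Fin k)) (n : Fin q.size) : NodeRep :=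
  (rep n, (q.lab n).elim [] fun a => [rep a])

theorem nodeRep_all (q : Twig (Fin k)) (n : Fin q.size) (a : Fin k) :
    ((nodeRep q n).2.all fun b => eqBits b (rep a)) = true ↔
      q.lab n = none ∨ q.lab n = some a := by
  unfold nodeRep
  cases q.lab n <;> simp [eqBits_rep]

theorem exists_of_edgesOk {q : Twig (Fin k)} {E G : RelRep}
    {F : Finset (Fin q.size × Fin q.size)} {R : Fin k → Fin k → Prop}
    (hE : Represents E fun n n' => (n, n') ∈ F) (hG : Represents G R)
    {T : List (NodeRep × Bits)}
    (hT : ∀ x ∈ T, ∃ (n : Fin q.size) (a : Fin k), x = (nodeRep q n, rep a))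
    {n : Fin q.size} {a : Fin k} (h : edgesOk E G T (nodeRep q n, rep a) = true)
    {n' : Fin q.size} (hn' : (n, n') ∈ F) : ∃ b, R a b ∧ (nodeRep q n', rep b) ∈ T := by
  simp only [edgesOk, List.all_eq_true, Bool.or_eq_true, Bool.not_eq_true', ← Bool.not_eq_true,
    List.any_eq_true, Bool.and_eq_true] at h
  obtain ⟨x, hx, h₁, h₂⟩ := (h _ ((hE _).2 ⟨n, n', rfl, hn'⟩)).resolve_left
    (not_not.2 (eqBits_rep.2 rfl))
  obtain ⟨m, b, rfl⟩ := hT x hx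
  cases eqBits_rep.1 h₁
  exact ⟨b, (hG.memPair a b).1 h₂, hx⟩

theorem edgesOk_of_exists {q : Twig (Fin k)} {E G : RelRep}
    {F : Finset (Fin q.size × Fin q.size)} {R : Fin k → Fin k → Prop}
    (hE : Represents E fun n n' => (n, n') ∈ F) (hG : Represents G R)
    {T : List (NodeRep × Bits)} {n : Fin q.size} {a : Fin k}
    (h : ∀ n', (n, n') ∈ F → ∃ b, R a b ∧ (nodeRep q n', rep b) ∈ T) :
    edgesOk E G T (nodeRep q n, rep a) = true := by
  simp only [edgesOk, List.all_eq_true, Bool.or_eq_true, Bool.not_eq_true', ← Bool.not_eq_true,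
    List.any_eq_true, Bool.and_eq_true]
  intro e he
  obtain ⟨m, n', rfl, hF⟩ := (hE e).1 he
  refine or_iff_not_imp_left.2 fun hm => ?_
  cases eqBits_rep.1 (not_not.1 hm)
  obtain ⟨b, hR, hb⟩ := h n' hF
  exact ⟨_, hb, eqBits_rep.2 rfl, (hG.memPair a b).2 hR⟩

/-- The representation `x` of the schema `S` and the query `q`. -/
structure IsRep (x : InstanceRep) (S : IMS (Fin k)) (q : Twig (Fin k)) : Prop where
  root : x.1.1 = rep S.root
  rules : x.1.2 = rulesRep S
  queryRoot : x.2.1 = rep q.root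
  nodes : x.2.2.1 = (List.finRange q.size).map (nodeRep q)
  child : Represents x.2.2.2.1 fun n n' => (n, n') ∈ q.child
  desc : Represents x.2.2.2.2 fun n n' => (n, n') ∈ q.desc

/-- The fixed-point property of `matching` gives the local compatibility conditions from which
`Twig.exists_hom` extracts an embedding. Conversely, the pairs of a query node and its image under
an embedding support one another and survive all rounds. -/
theorem IsRep.embeds_iff {x : InstanceRep} {q : Twig (Fin k)} (h : IsRep x S q) {E : RelRep}
    {G : DepGraph (Fin k)} (hG : Represents E G.edge) (hr : G.root = S.root) :
    embeds x E = true ↔ G.Embeds q := by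
  unfold embeds
  rw [h.rules, map_rulesRep, h.nodes, h.root, h.queryRoot]
  have hmem : ∀ y, y ∈ ((List.finRange q.size).map (nodeRep q)).product (reps k) ↔
      ∃ (n : Fin q.size) (a : Fin k), y = (nodeRep q n, rep a) := by
    rintro ⟨y, z⟩
    simp only [List.pair_mem_product, List.mem_map, List.mem_finRange, true_and, mem_reps,
      Prod.mk.injEq]
    constructor
    · rintro ⟨⟨n, rfl⟩, a, rfl⟩
      exact ⟨n, a, rfl, rfl⟩
    · rintro ⟨n, a, rfl, rfl⟩
      exact ⟨⟨n, rfl⟩, a, rfl⟩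
  have hT : ∀ y ∈ matching ((List.finRange q.size).map (nodeRep q)) x.2.2.2.1 x.2.2.2.2 E
      (closure E (reps k)) (reps k), ∃ (n : Fin q.size) (a : Fin k), y = (nodeRep q n, rep a) := fun y hy =>
    (hmem y).1 (shrink_subset hy)
  rw [List.any_eq_true]
  constructor
  · rintro ⟨y, hy, h'⟩
    obtain ⟨n, a, rfl⟩ := hT y hy
    rw [Bool.and_eq_true] at h'
    cases eqBits_rep.1 h'.1
    cases eqBits_rep.1 h'.2
    have key : ∀ n a, (nodeRep q n, rep a) ∈ matching ((List.finRange q.size).map (nodeRep q))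
        x.2.2.2.1 x.2.2.2.2 E (closure E (reps k)) (reps k) → _ :=
      fun (n : Fin q.size) (a : Fin k) hy => shrink_fixed hy
    simp only [Bool.and_eq_true, nodeRep_all] at key
    obtain ⟨f, h₁, h₂, h₃, h₄, _⟩ := q.exists_hom G.edge id S.root
      (fun n a => (nodeRep q n, rep a) ∈ matching ((List.finRange q.size).map (nodeRep q))
        x.2.2.2.1 x.2.2.2.2 E (closure E (reps k)) (reps k)) hy
      (fun n a ha => (key n a ha).1.1)
      (fun n a ha n' => exists_of_edgesOk h.child hG hT (key n a ha).1.2)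
      (fun n a ha n' => exists_of_edgesOk h.desc hG.closure hT (key n a ha).2)
    exact ⟨f, h₁.trans hr.symm, h₂, h₃, h₄⟩
  · rintro ⟨f, h₁, h₂, h₃, h₄⟩
    refine ⟨(nodeRep q q.root, rep S.root), ?_, ?_⟩
    · refine subset_shrink (Q := fun y => ∃ n, y = (nodeRep q n, rep (f n))) ?_ ?_
        ⟨q.root, by rw [h₁, hr]⟩
      · rintro _ ⟨n, rfl⟩
        exact (hmem _).2 ⟨n, _, rfl⟩
      · rintro s hs _ ⟨n, rfl⟩
        rw [Bool.and_eq_true, Bool.and_eq_true, nodeRep_all]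
        exact ⟨⟨h₄ n, edgesOk_of_exists h.child hG fun n' h' =>
          ⟨f n', h₂ n n' h', hs _ ⟨n', rfl⟩⟩⟩, edgesOk_of_exists h.desc hG.closure fun n' h' =>
          ⟨f n', h₃ n n' h', hs _ ⟨n', rfl⟩⟩⟩
    · rw [Bool.and_eq_true]
      exact ⟨eqBits_rep.2 rfl, eqBits_rep.2 rfl⟩

theorem IsRep.decideSat_iff {x : InstanceRep} {q : Twig (Fin k)} (h : IsRep x S q) :
    decideSat x = true ↔ S.Sat q := by
  rw [IMS.sat_iff, ← h.embeds_iff represents_prunedEdges rfl, ← memBits_unproductive, decideSat,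
    h.rules, h.root, Bool.and_eq_true, Bool.not_eq_true']

theorem IsRep.decideImpl_iff {x : InstanceRep} {q : Twig (Fin k)} (h : IsRep x S q) :
    decideImpl x = true ↔ S.Implies q := by
  rw [IMS.implies_iff, ← h.embeds_iff represents_forallEdges rfl, ← memBits_unproductive,
    decideImpl, h.rules, h.root, Bool.or_eq_true, ← Bool.not_eq_true, or_iff_not_imp_left]

end correct

end Unordered


/-! ### Reading an instance -/

namespace Unordered

open StackProg

/-- The state of the parser, which reads the word from right to left. -/
structure ParseState where
  /-- the digits read since the last keyword -/
  bits : Bits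
  /-- whether the upper end of the current interval is `∞` -/
  inf : Bool
  /-- whether the current interval is of the form `[n, m]^?` -/
  opt : Bool
  /-- the lower end of the current interval or the target of the current edge -/
  low : Bits
  /-- the upper end of the current interval or the label of the current node -/
  high : List Bits
  /-- the symbols of the current atom -/
  atom : List (Bits × Bool)
  /-- the factors of the current expression -/
  factors : List FactorRep
  /-- the part of the instance that has been read -/
  out : InstanceRep

namespace ParseState

/-- The state as a tuple. -/
def tuple (s : ParseState) :
    Bits × Bool × Bool × Bits × List Bits × List (Bits × Bool) × List FactorRep × InstanceRep :=
  (s.bits, s.inf, s.opt, s.low, s.high, s.atom, s.factors, s.out)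

instance : Code ParseState := ⟨fun s => code s.tuple⟩

/-- The state between two rules, nodes or edges. -/
def between (o : InstanceRep) : ParseState := ⟨[], false, false, [], [], [], [], o⟩

/-- The state between two factors of an expression. -/
def inRule (fs : List FactorRep) (o : InstanceRep) : ParseState :=
  ⟨[], false, false, [], [], [], fs, o⟩

/-- The transition function of the parser. -/
def step : Letter → ParseState → ParseState
  | .bit b, s => ⟨b :: s.bits, s.inf, s.opt, s.low, s.high, s.atom, s.factors, s.out⟩
  | .schemaRoot, s => between ((s.bits, s.out.1.2), s.out.2)
  | .rule, s => between ((s.out.1.1, (s.bits, s.factors) :: s.out.1.2), s.out.2)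
  | .atom, s => inRule ((s.atom, s.low, s.high, s.opt) :: s.factors) s.out
  | .required, s =>
      ⟨[], s.inf, s.opt, s.low, s.high, (s.bits, false) :: s.atom, s.factors, s.out⟩
  | .optional, s =>
      ⟨[], s.inf, s.opt, s.low, s.high, (s.bits, true) :: s.atom, s.factors, s.out⟩
  | .lower, s => ⟨[], s.inf, s.opt, s.bits, s.high, s.atom, s.factors, s.out⟩
  | .upper, s => ⟨[], false, s.opt, s.low, bif s.inf then [] else [s.bits], s.atom, s.factors, s.out⟩
  | .infinity, s => ⟨s.bits, true, s.opt, s.low, s.high, s.atom, s.factors, s.out⟩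
  | .orEmpty, s => ⟨s.bits, s.inf, true, s.low, s.high, s.atom, s.factors, s.out⟩
  | .queryRoot, s => between (s.out.1, s.bits, s.out.2.2)
  | .node, s => between (s.out.1, s.out.2.1, (s.bits, s.high) :: s.out.2.2.1, s.out.2.2.2)
  | .label, s => ⟨[], s.inf, s.opt, s.low, [s.bits], s.atom, s.factors, s.out⟩
  | .wildcard, s => ⟨[], s.inf, s.opt, s.low, [], s.atom, s.factors, s.out⟩
  | .child, s => between (s.out.1, s.out.2.1, s.out.2.2.1,
      (s.bits, s.low) :: s.out.2.2.2.1, s.out.2.2.2.2)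
  | .desc, s => between (s.out.1, s.out.2.1, s.out.2.2.1, s.out.2.2.2.1,
      (s.bits, s.low) :: s.out.2.2.2.2)
  | .target, s => ⟨[], s.inf, s.opt, s.bits, s.high, s.atom, s.factors, s.out⟩

end ParseState

open ParseState

/-! ### The parser is polynomial-time -/

section ptime

variable {γ : Type} [Code γ] {f : γ → ParseState}

theorem PTime.tuple (hf : PTime f) : PTime fun c => (f c).tuple := hf

@[fun_prop]
theorem PTime.parseState_bits (hf : PTime f) : PTime fun c => (f c).bits := (PTime.tuple hf).fst

@[fun_prop]
theorem PTime.parseState_inf (hf : PTime f) : PTime fun c => (f c).inf := (PTime.tuple hf).snd.fst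

@[fun_prop]
theorem PTime.parseState_opt (hf : PTime f) : PTime fun c => (f c).opt := (PTime.tuple hf).snd.snd.fst

@[fun_prop]
theorem PTime.parseState_low (hf : PTime f) : PTime fun c => (f c).low :=
  (PTime.tuple hf).snd.snd.snd.fst

@[fun_prop]
theorem PTime.parseState_high (hf : PTime f) : PTime fun c => (f c).high :=
  (PTime.tuple hf).snd.snd.snd.snd.fst

@[fun_prop]
theorem PTime.parseState_atom (hf : PTime f) : PTime fun c => (f c).atom :=
  (PTime.tuple hf).snd.snd.snd.snd.snd.fst

@[fun_prop]
theorem PTime.parseState_factors (hf : PTime f) : PTime fun c => (f c).factors :=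
  (PTime.tuple hf).snd.snd.snd.snd.snd.snd.fst

@[fun_prop]
theorem PTime.parseState_out (hf : PTime f) : PTime fun c => (f c).out :=
  (PTime.tuple hf).snd.snd.snd.snd.snd.snd.snd

@[fun_prop]
theorem PTime.parseState_mk {bits low : γ → Bits} {inf opt : γ → Bool} {high : γ → List Bits}
    {atom : γ → List (Bits × Bool)} {factors : γ → List FactorRep} {out : γ → InstanceRep}
    (h₁ : PTime bits) (h₂ : PTime inf) (h₃ : PTime opt) (h₄ : PTime low) (h₅ : PTime high)
    (h₆ : PTime atom) (h₇ : PTime factors) (h₈ : PTime out) :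
    PTime fun c => ParseState.mk (bits c) (inf c) (opt c) (low c) (high c) (atom c) (factors c)
      (out c) :=
  h₁.pair (h₂.pair (h₃.pair (h₄.pair (h₅.pair (h₆.pair (h₇.pair h₈))))))

theorem PTime.parseState_step (x : Letter) : PTime (step x) := by
  cases x <;> unfold step <;> (try unfold between) <;> (try unfold inRule) <;> fun_prop

end ptime

theorem len_parseState (s : ParseState) : len s = 7 + len s.bits + len s.inf + len s.opt +
    len s.low + len s.high + len s.atom + len s.factors + len s.out.1.1 + len s.out.1.2 +
    len s.out.2.1 + len s.out.2.2.1 + len s.out.2.2.2.1 + len s.out.2.2.2.2 + 5 := by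
  have : len s = len s.tuple := rfl
  rw [this, tuple, len_pair, len_pair, len_pair, len_pair, len_pair, len_pair, len_pair]
  have : len s.out = 1 + (1 + len s.out.1.1 + len s.out.1.2) + (1 + len s.out.2.1 +
    (1 + len s.out.2.2.1 + (1 + len s.out.2.2.2.1 + len s.out.2.2.2.2))) := rfl
  rw [this]
  omega

/-- No transition copies a component: data are moved or dropped, and only boundedly many
constructors and flags are added. The constant is chosen generously. -/
theorem len_step_le (x : Letter) (s : ParseState) : len (step x s) ≤ len s + 40 := by
  have h₁ := one_le_len s.bits
  have h₂ := one_le_len s.inf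
  have h₃ := one_le_len s.opt
  have h₄ := one_le_len s.low
  have h₅ := one_le_len s.high
  have h₆ := one_le_len s.atom
  have h₇ := one_le_len s.factors
  have h₈ := one_le_len s.out.1.1
  have h₉ := one_le_len s.out.2.1
  have h₁₀ := len_bool_le true
  have h₁₁ := len_bool_le false
  cases x with
  | bit b =>
    have := len_bool_le b
    simp only [step, len_parseState, len_cons]; omega
  | upper =>
    rw [len_parseState, len_parseState]
    simp only [step]
    cases s.inf <;> simp only [cond_true, cond_false, len_cons, len_nil] <;> omega
  | _ =>
    simp only [step, between, inRule, len_parseState, len_cons, len_nil, len_pair]; omega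

/-! ### Correctness of the parser -/

/-- The common pattern for symbols, factors, rules, nodes and edges: `mk` is the parser state as a
function of the list being built, and reading one block puts one entry in front. Reading from right
to left keeps the order. -/
theorem foldr_flatMap_eq {α β σ : Type} (F : α → σ → σ) (g : β → List α) (mk : List γ → σ)
    (r : β → γ) (h : ∀ x l, (g x).foldr F (mk l) = mk (r x :: l)) (l : List β) (l' : List γ) :
    (l.flatMap g).foldr F (mk l') = mk (l.map r ++ l') := by
  induction l with
  | nil => rfl
  | cons x l ih => rw [List.flatMap_cons, List.foldr_append, ih, h]; rfl

theorem foldr_digits (n : ℕ) (s : ParseState) (h : s.bits = []) : (digits n).foldr step s =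
    ⟨Computability.encodeNat n, s.inf, s.opt, s.low, s.high, s.atom, s.factors, s.out⟩ := by
  unfold digits
  generalize Computability.encodeNat n = l
  induction l with
  | nil => cases s; cases h; rfl
  | cons b l ih => rw [List.map_cons, List.foldr_cons, ih]; rfl

/-- Zero has no digits, so an upper end `∞` cannot be recognized by the absence of digits; the flag
`inf` separates the two cases. -/
theorem foldr_encodeInterval (I : Interval) (fs : List FactorRep) (o : InstanceRep) :
    (encodeInterval I).foldr step (inRule fs o) =
      ⟨[], false, I.orEmpty, Computability.encodeNat I.lo, upperRep I.hi, [], fs, o⟩ := by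
  have h : (if I.orEmpty then [Letter.orEmpty] else []).foldr step (inRule fs o) =
      ⟨[], false, I.orEmpty, [], [], [], fs, o⟩ := by
    cases I.orEmpty <;> rfl
  have h' : (Letter.upper :: encodeUpper I.hi).foldr step
      ⟨[], false, I.orEmpty, [], [], [], fs, o⟩ =
      ⟨[], false, I.orEmpty, [], upperRep I.hi, [], fs, o⟩ := by
    rcases I.hi with _ | m
    · rfl
    · rw [List.foldr_cons, encodeUpper, foldr_digits _ _ rfl]; rfl
  rw [encodeInterval, List.foldr_append, h, List.cons_append, List.foldr_cons, List.foldr_append,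
    h', foldr_digits _ _ rfl]
  rfl

theorem foldr_encodeFactor {k : ℕ} (f : Atom (Fin k) × Interval) (fs : List FactorRep)
    (o : InstanceRep) : (encodeAtom f.1 ++ encodeInterval f.2).foldr step (inRule fs o) =
      inRule ((atomRep f.1, Computability.encodeNat f.2.lo, upperRep f.2.hi, f.2.orEmpty) :: fs)
        o := by
  rw [List.foldr_append, foldr_encodeInterval, encodeAtom, List.foldr_cons,
    foldr_flatMap_eq step _ (fun l => ⟨[], false, f.2.orEmpty, Computability.encodeNat f.2.lo,
      upperRep f.2.hi, l, fs, o⟩) (fun p : Fin k × Bool => (rep p.1, p.2))]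
  · rw [List.append_nil]; rfl
  · rintro ⟨a, b⟩ l
    rw [List.foldr_cons, foldr_digits _ _ rfl]
    cases b <;> rfl

theorem foldr_encodeRules {k : ℕ} (S : IMS (Fin k)) (r : Bits) (q) :
    ((List.finRange k).flatMap fun a : Fin k =>
      Letter.rule :: digits a ++ encodeIME (S.rule a)).foldr step (between ((r, []), q)) =
      between ((r, rulesRep S), q) := by
  rw [foldr_flatMap_eq step _ (fun l => between ((r, l), q))
    (fun a : Fin k => (rep a, imeRep (S.rule a)))]
  · rw [List.append_nil]; rfl
  · intro a l
    have h : (encodeIME (S.rule a)).foldr step (between ((r, l), q)) =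
        inRule (imeRep (S.rule a)) ((r, l), q) := by
      have := foldr_flatMap_eq step (fun f : Atom (Fin k) × Interval =>
        encodeAtom f.1 ++ encodeInterval f.2) (fun fs => inRule fs ((r, l), q)) _
        (fun f fs => foldr_encodeFactor f fs _) (S.rule a).factors []
      rwa [List.append_nil] at this
    rw [List.foldr_append, h, List.foldr_cons, foldr_digits _ _ rfl]
    rfl

/-- The representation of the edges of a query. -/
def edgesRep {n : ℕ} (E : Finset (Fin n × Fin n)) : RelRep :=
  ((List.finRange n ×ˢ List.finRange n).filter (· ∈ E)).map fun e => (rep e.1, rep e.2)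

theorem represents_edgesRep {n : ℕ} (E : Finset (Fin n × Fin n)) :
    Represents (edgesRep E) fun a b => (a, b) ∈ E := by
  intro e
  simp [edgesRep, eq_comm, and_comm]

theorem foldr_encodeChild {n : ℕ} (E : Finset (Fin n × Fin n)) (s : Bits × RulesRep) (r : Bits)
    (N : List NodeRep) (d : RelRep) :
    (encodeEdges Letter.child E).foldr step (between (s, r, N, [], d)) =
      between (s, r, N, edgesRep E, d) := by
  rw [encodeEdges, foldr_flatMap_eq step _ (fun l => between (s, r, N, l, d))
    (fun e : Fin n × Fin n => (rep e.1, rep e.2))]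
  · rw [List.append_nil]; rfl
  · intro e l
    rw [List.foldr_append, List.foldr_cons, foldr_digits _ _ rfl, List.foldr_cons,
      foldr_digits _ _ rfl]
    rfl

theorem foldr_encodeDesc {n : ℕ} (E : Finset (Fin n × Fin n)) (s : Bits × RulesRep) (r : Bits)
    (N : List NodeRep) (c : RelRep) :
    (encodeEdges Letter.desc E).foldr step (between (s, r, N, c, [])) =
      between (s, r, N, c, edgesRep E) := by
  rw [encodeEdges, foldr_flatMap_eq step _ (fun l => between (s, r, N, c, l))
    (fun e : Fin n × Fin n => (rep e.1, rep e.2))]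
  · rw [List.append_nil]; rfl
  · intro e l
    rw [List.foldr_append, List.foldr_cons, foldr_digits _ _ rfl, List.foldr_cons,
      foldr_digits _ _ rfl]
    rfl

theorem foldr_encodeNodes {k : ℕ} (q : Twig (Fin k)) (s : Bits × RulesRep) (r : Bits)
    (c d : RelRep) :
    ((List.finRange q.size).flatMap fun v : Fin q.size =>
      Letter.node :: digits v ++ encodeLabel (q.lab v)).foldr step (between (s, r, [], c, d)) =
      between (s, r, (List.finRange q.size).map (nodeRep q), c, d) := by
  rw [foldr_flatMap_eq step _ (fun l => between (s, r, l, c, d)) (nodeRep q)]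
  · rw [List.append_nil]
  · intro v l
    have h : (encodeLabel (q.lab v)).foldr step (between (s, r, l, c, d)) =
        ⟨[], false, false, [], (nodeRep q v).2, [], [], (s, r, l, c, d)⟩ := by
      unfold nodeRep
      cases q.lab v with
      | none => rfl
      | some a => rw [encodeLabel, List.foldr_cons, foldr_digits _ _ rfl]; rfl
    rw [List.foldr_append, h, List.foldr_cons, foldr_digits _ _ rfl]
    rfl

/-- The parser reads the word that represents an instance correctly. -/
theorem foldr_encode (x : Instance) :
    (x.encode.foldr step (between (([], []), [], [], [], []))).out =
      ((rep x.schema.root, rulesRep x.schema), rep x.query.root,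
        (List.finRange x.query.size).map (nodeRep x.query), edgesRep x.query.child,
        edgesRep x.query.desc) := by
  have h : ∀ (s : Bits × RulesRep) (n : ℕ) (q : List NodeRep × RelRep × RelRep),
      (Letter.queryRoot :: digits n).foldr step (between (s, [], q)) =
        between (s, Computability.encodeNat n, q) := fun s n q => by
    rw [List.foldr_cons, foldr_digits _ _ rfl]; rfl
  rw [Instance.encode, encodeIMS, encodeTwig, List.foldr_append, List.foldr_append,
    List.foldr_append, List.foldr_append, foldr_encodeDesc, foldr_encodeChild, List.foldr_append,
    foldr_encodeNodes, h, foldr_encodeRules, List.foldr_cons, foldr_digits _ _ rfl]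
  rfl

theorem isRep_foldr_encode (x : Instance) :
    IsRep (x.encode.foldr step (between (([], []), [], [], [], []))).out x.schema x.query := by
  rw [foldr_encode]
  exact ⟨rfl, rfl, rfl, rfl, represents_edgesRep _, represents_edgesRep _⟩

/-- A problem that is solved by a polynomial-time function on the representations of instances
is in PTIME. -/
theorem inPTIME_of_pTime {P : Set Instance} {p : InstanceRep → Bool} (hp : PTime p)
    (h : ∀ x : Instance,
      p (x.encode.foldr step (between (([], []), [], [], [], []))).out = true ↔ x ∈ P) :
    InPTIME Instance.encode P :=
  ⟨_, h, computable_of_foldr Instance.encode (between (([], []), [], [], [], [])) step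
    PTime.parseState_step 40 len_step_le (post := fun s => p s.out)
    (hp.comp (PTime.parseState_out PTime.id)) _ fun _ => rfl⟩

end Unordered

theorem mainTheorem3 :
    Unordered.InPTIME Unordered.Instance.encode Unordered.satProblem ∧
    Unordered.InPTIME Unordered.Instance.encode Unordered.implProblem ∧
    (∀ (A : Type) [Finite A] (S : Unordered.IMS A) (q : Unordered.Twig A),
      S.Satisfiable → S.Trimmed →
        (S.Sat q ↔ S.existsGraph.Embeds q) ∧ (S.Implies q ↔ S.forallGraph.Embeds q)) := by
  refine ⟨Unordered.inPTIME_of_pTime Unordered.PTime.decideSat fun x =>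
      (Unordered.isRep_foldr_encode x).decideSat_iff,
    Unordered.inPTIME_of_pTime Unordered.PTime.decideImpl fun x =>
      (Unordered.isRep_foldr_encode x).decideImpl_iff, fun A _ S q hS hT => ?_⟩
  have hP := Unordered.IMS.satisfiable_iff.1 hS
  constructor
  · rw [Unordered.IMS.sat_iff, hT.prunedGraph_eq]
    -- Satisfiability of the schema is productivity of its root, which removes the extra conjunct
    -- here and the premise in the implication case.
    exact and_iff_right hP
  · rw [Unordered.IMS.implies_iff]
    exact ⟨fun h => h hP, fun h _ => h⟩
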